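/- **Setting.** Let $s\ge 1$ and let $\mathbf M$ be an irreducible $s\times s$ matrix with entries in $\{0,1\}$. Let $\Sigma=\{\mathbf x=(x_0,x_1,\dots) : \mathbf M(x_j,x_{j+1})=1\ \forall j\ge 0\}$, $\Sigma^*=\{\mathbf y=(\dots,y_2,y_1) : \mathbf M(y_{j+1},y_j)=1\ \forall j\ge 1\}$ and $\hat\Sigma=\{(\mathbf y,\mathbf x)\in\Sigma^*\times\Sigma : \mathbf M(y_1,x_0)=1\}$. Put $\Sigma^*_{\mathbf x}=\{\mathbf y : (\mathbf y,\mathbf x)\in\hat\Sigma\}$ and $\tau_{\mathbf y}(\mathbf x)=(y_1,x_0,x_1,\dots)$ for $(\mathbf y,\mathbf x)\in\hat\Sigma$. Fix $\lambda\in(0,1)$. Two distinct sequences have distance $d=\lambda^k$, where $k$ counts the coordinates before the first one at which they differ (coordinates being read in the order $x_0,x_1,\dots$, respectively $y_1,y_2,\dots$); $\hat\Sigma$ carries the maximum of the two distances. Let $A:\hat\Sigma\to\mathbb R$ be Hölder. A Borel probability measure $\hat\mu$ on $\hat\Sigma$ is *holonomic* if $\int f(\tau_{\mathbf y}(\mathbf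 x))\,d\hat\mu=\int f(\mathbf x)\,d\hat\mu$ for all $f\in C^0(\Sigma)$, and $\bar A$ is the minimum of $\int A\,d\hat\mu$ over holonomic $\hat\mu$. A *sub-action* is a continuous $u:\Sigma\to\mathbb R$ with $u(\mathbf x)-u(\tau_{\mathbf y}(\mathbf x))\le A(\mathbf y,\mathbf x)-\bar A$ on $\hat\Sigma$; it is *calibrated* if $u(\mathbf x)=\min_{\mathbf y\in\Sigma^*_{\mathbf x}}[u(\tau_{\mathbf y}(\mathbf x))+A(\mathbf y,\mathbf x)-\bar A]$ for all $\mathbf x\in\Sigma$. A *path of length $k$* is a sequence $\mathbf z^i=(\mathbf y^i,\mathbf x^i)\in\hat\Sigma$, $0\le i\le k$, with $\mathbf x^{i}=\tau_{\mathbf y^{i+1}}(\mathbf x^{i+1})$ for $i<k$; $\mathcal P_k(\mathbf x,\bar{\mathbf x},\epsilon)$ is the set of those with $d(\mathbf x^0,\mathbf x)<\epsilon$ and $d(\mathbf x^k,\bar{\mathbf x})<\epsilon$. The set $\Omega(A)$ of *non-wandering points* consists of the $\mathbf x\in\Sigma$ such that for every $\epsilon>0$ there are $k\ge1$ and a path in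 $\mathcal P_k(\mathbf x,\mathbf x,\epsilon)$ with $|\sum_{i=1}^k(A-\bar A)(\mathbf z^i)|<\epsilon$. The *Peierls barrier* is $$h_A(\mathbf x,\bar{\mathbf x})=\lim_{\epsilon\to0}\liminf_{k\to\infty}\inf\Big\{\sum_{i=1}^k(A-\bar A)(\mathbf z^i) : (\mathbf z^0,\dots,\mathbf z^k)\in\mathcal P_k(\mathbf x,\bar{\mathbf x},\epsilon)\Big\}\in\mathbb R\cup\{+\infty\}.$$ The *irreducible components* are the classes of the equivalence relation $\mathbf x\sim\bar{\mathbf x}\iff h_A(\mathbf x,\bar{\mathbf x})+h_A(\bar{\mathbf x},\mathbf x)=0$ on $\Omega(A)$. **Theorem.** Assume that $\Omega(A)=C_1\sqcup\dots\sqcup C_r$ is a disjoint union of finitely many irreducible components. Choose $\bar{\mathbf x}^i\in C_i$ and set $$\mathcal C=\{(u_1,\dots,u_r)\in\mathbb R^r : u_j-u_i\le h_A(\bar{\mathbf x}^i,\bar{\mathbf x}^j)\ \forall i,j\}.$$ 1. If $u$ is a calibrated sub-action, then $(u(\bar{\mathbf x}^1),\dots,u(\bar{\mathbf x}^r))\in\mathcal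 C$ and $u(\mathbf x)=\min_{1\le i\le r}[u(\bar{\mathbf x}^i)+h_A(\bar{\mathbf x}^i,\mathbf x)]$ for all $\mathbf x\in\Sigma$. 2. If $(u_1,\dots,u_r)\in\mathcal C$, then $u(\mathbf x):=\min_{1\le i\le r}[u_i+h_A(\bar{\mathbf x}^i,\mathbf x)]$ is a (real-valued, continuous) calibrated sub-action with $u(\bar{\mathbf x}^i)=u_i$ for all $i$. Hence $u\mapsto(u(\bar{\mathbf x}^i))_i$ is a bijection from the calibrated sub-actions onto $\mathcal C$. 3. Let $i_0\in\{1,\dots,r\}$ and $u_{i_0}\in\mathbb R$, and put $u_i:=u_{i_0}+h_A(\bar{\mathbf x}^{i_0},\bar{\mathbf x}^i)$ for all $i$. These are real numbers, consistent at $i=i_0$; $i_0$ is the only index $i_1$ such that $u_i=u_{i_1}+h_A(\bar{\mathbf x}^{i_1},\bar{\mathbf x}^i)$ for all $i$; $(u_1,\dots,u_r)\in\mathcal C$; and the unique calibrated sub-action $u$ with $u(\bar{\mathbf x}^i)=u_i$ for all $i$ is $u(\mathbf x)=\min_{1\le i\le r}[u_i+h_A(\bar{\mathbf x}^i,\mathbf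 x)]=u_{i_0}+h_A(\bar{\mathbf x}^{i_0},\mathbf x)$. -/

import Mathlib

open Set Filter Topology MeasureTheory

namespace HolonomicModel

noncomputable section

variable {s : ℕ}

/-- The distance `lam ^ k`, `k` the first index at which the sequences differ (and `0` if they
are equal). -/
def seqDist (lam : ℝ) (a b : ℕ → Fin s) : ℝ :=
  open Classical in if a = b then 0 else lam ^ PiNat.firstDiff (E := fun _ => Fin s) a b

/-- The one-sided subshift of finite type with transition matrix `M`. Its topology and its Borel
sigma-algebra are induced by the product structure of `ℕ → Fin s`. -/
abbrev Shift (M : Matrix (Fin s) (Fin s) ℤ) : Type :=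
  {x : ℕ → Fin s // ∀ j, M (x j) (x (j + 1)) = 1}

/-- The dual subshift: a point `(…, y₃, y₂, y₁)` is stored as the sequence `j ↦ y_{j+1}`. -/
abbrev DualShift (M : Matrix (Fin s) (Fin s) ℤ) : Type :=
  {y : ℕ → Fin s // ∀ j, M (y (j + 1)) (y j) = 1}

/-- The natural extension: pairs `(y, x) = (…, y₂, y₁ | x₀, x₁, …)` with `M(y₁, x₀) = 1`. -/
abbrev NatExt (M : Matrix (Fin s) (Fin s) ℤ) : Type :=
  {z : DualShift M × Shift M // M (z.1.1 0) (z.2.1 0) = 1}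

variable {M : Matrix (Fin s) (Fin s) ℤ}

/-- The projection `(y, x) ↦ x`. -/
def proj (z : NatExt M) : Shift M := z.1.2

/-- The inverse branch `τ_y(x) = (y₁, x₀, x₁, …)`. -/
def tau (z : NatExt M) : Shift M :=
  ⟨fun n => Nat.casesOn n (z.1.1.1 0) (fun m => z.1.2.1 m), by
    intro j
    cases j with
    | zero => exact z.2
    | succ m => exact z.1.2.2 m⟩

/-- Hölder observables on the natural extension, which carries the maximum of the two
coordinate distances. -/
def IsHolderObservable (lam : ℝ) (A : NatExt M → ℝ) : Prop :=
  ∃ θ : ℝ, 0 < θ ∧ ∃ K : ℝ, ∀ z w : NatExt M,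
    |A z - A w| ≤ K * (max (seqDist lam z.1.1.1 w.1.1.1) (seqDist lam z.1.2.1 w.1.2.1)) ^ θ

/-- Holonomic probability measures. -/
def IsHolonomic (μ : Measure (NatExt M)) : Prop :=
  IsProbabilityMeasure μ ∧
    ∀ f : C(Shift M, ℝ), ∫ z, f (tau z) ∂μ = ∫ z, f (proj z) ∂μ

/-- The holonomic minimizing value of `A`. -/
def minValue (A : NatExt M → ℝ) : ℝ :=
  sInf {a : ℝ | ∃ μ : Measure (NatExt M), IsHolonomic μ ∧ a = ∫ z, A z ∂μ}

/-- Continuous sub-actions. -/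
def IsSubAction (A : NatExt M → ℝ) (u : Shift M → ℝ) : Prop :=
  Continuous u ∧ ∀ z : NatExt M, u (proj z) - u (tau z) ≤ A z - minValue A

/-- Continuous calibrated sub-actions: `u(x)` is the minimum over `y ∈ Σ*_x` of
`u(τ_y(x)) + A(y, x) - Ā`. -/
def IsCalibrated (A : NatExt M → ℝ) (u : Shift M → ℝ) : Prop :=
  IsSubAction A u ∧ ∀ x : Shift M,
    IsLeast {a : ℝ | ∃ z : NatExt M, proj z = x ∧ a = u (tau z) + A z - minValue A} (u x)

/-- Paths of length `k` which begin within `ε` of `x` and end within `ε` of `x'`. -/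
def pathsNear (lam : ℝ) (k : ℕ) (x x' : Shift M) (ε : ℝ) : Set (Fin (k + 1) → NatExt M) :=
  {z | (∀ i : Fin k, proj (z i.castSucc) = tau (z i.succ)) ∧
    seqDist lam (proj (z 0)).1 x.1 < ε ∧ seqDist lam (proj (z (Fin.last k))).1 x'.1 < ε}

/-- The action `∑_{i=1}^k (A - Ā)(z^i)` of a path; the initial point `z^0` does not contribute. -/
def action (A : NatExt M → ℝ) {k : ℕ} (z : Fin (k + 1) → NatExt M) : ℝ :=
  ∑ i : Fin k, (A (z i.succ) - minValue A)

/-- The set `Ω(A)` of non-wandering points with respect to `A`. -/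
def nonWandering (lam : ℝ) (A : NatExt M → ℝ) : Set (Shift M) :=
  {x | ∀ ε : ℝ, 0 < ε → ∃ k : ℕ, 1 ≤ k ∧ ∃ z ∈ pathsNear lam k x x ε, |action A z| < ε}

/-- The infimum of the actions of the paths of length `k` from `x` to `x'` up to `ε`; it is `+∞`
if there is no such path. -/
def minAction (lam : ℝ) (A : NatExt M → ℝ) (ε : ℝ) (x x' : Shift M) (k : ℕ) : EReal :=
  ⨅ z ∈ pathsNear lam k x x' ε, ((action A z : ℝ) : EReal)

/-- The Peierls barrier `h_A(x, x')`, the limit as `ε → 0` of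
`liminf_{k → ∞} minAction lam A ε x x' k`. This quantity is nonincreasing in `ε`, so its limit is
its supremum over `ε > 0`, see `tendsto_peierls`. -/
def peierls (lam : ℝ) (A : NatExt M → ℝ) (x x' : Shift M) : EReal :=
  ⨆ ε : {ε : ℝ // 0 < ε}, liminf (fun k => minAction lam A ε.1 x x' k) atTop

theorem minAction_anti (lam : ℝ) (A : NatExt M → ℝ) (x x' : Shift M) (k : ℕ) {ε δ : ℝ}
    (h : ε ≤ δ) : minAction lam A δ x x' k ≤ minAction lam A ε x x' k :=
  biInf_mono fun _ hz => ⟨hz.1, hz.2.1.trans_le h, hz.2.2.trans_le h⟩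

theorem tendsto_peierls (lam : ℝ) (A : NatExt M → ℝ) (x x' : Shift M) :
    Tendsto (fun ε : ℝ => liminf (fun k => minAction lam A ε x x' k) atTop) (𝓝[>] 0)
      (𝓝 (peierls lam A x x')) := by
  have anti : ∀ {ε δ : ℝ}, ε ≤ δ → liminf (fun k => minAction lam A δ x x' k) atTop ≤
      liminf (fun k => minAction lam A ε x x' k) atTop := fun h =>
    liminf_le_liminf (Eventually.of_forall fun k => minAction_anti lam A x x' k h)
  refine tendsto_order.2 ⟨fun a ha => ?_, fun a ha => ?_⟩
  · obtain ⟨δ, hδ⟩ := lt_iSup_iff.1 ha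
    filter_upwards [Ioc_mem_nhdsGT δ.2] with ε hε
    exact hδ.trans_le (anti hε.2)
  · filter_upwards [self_mem_nhdsWithin] with ε hε
    exact (le_iSup (fun ε : {ε : ℝ // 0 < ε} =>
      liminf (fun k => minAction lam A ε.1 x x' k) atTop) ⟨ε, hε⟩).trans_lt ha

/-- The relation `h_A(x, x') + h_A(x', x) = 0` between points of `Ω(A)`. In `EReal` the sum is `0`
only if both terms are finite. -/
def Equivalent (lam : ℝ) (A : NatExt M → ℝ) (x x' : Shift M) : Prop :=
  x ∈ nonWandering lam A ∧ x' ∈ nonWandering lam A ∧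
    peierls lam A x x' + peierls lam A x' x = 0

/-- Irreducible components: the equivalence classes in `Ω(A)`. -/
def IsIrreducibleComponent (lam : ℝ) (A : NatExt M → ℝ) (C : Set (Shift M)) : Prop :=
  ∃ x ∈ nonWandering lam A, C = {x' | Equivalent lam A x x'}

/-- The sub-action constraint set of the points `p 0, …, p (r - 1)`. -/
def constraintSet (lam : ℝ) (A : NatExt M → ℝ) {r : ℕ} (p : Fin r → Shift M) :
    Set (Fin r → ℝ) :=
  {v | ∀ i j, ((v j - v i : ℝ) : EReal) ≤ peierls lam A (p i) (p j)}

/-- `u(x)` is the minimum over `i` of `v i + h_A(p i, x)`, for every `x`. -/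
def IsMinFormula (lam : ℝ) (A : NatExt M → ℝ) {r : ℕ} (p : Fin r → Shift M) (v : Fin r → ℝ)
    (u : Shift M → ℝ) : Prop :=
  ∀ x, IsLeast (range fun i => (v i : EReal) + peierls lam A (p i) x) (u x : EReal)

end

end HolonomicModel

/-! Along a path the points x^i run through a forward orbit of the shift; only the pasts y^i are
free. Minimizing `A` over all (y, x) with τ_y(x) = w and subtracting Ā gives a one-sided potential
φ(w) (`potential`), which inherits exponentially small variation from the Hölder condition. Optimal
pasts exist by compactness, so least actions of paths are Birkhoff sums of φ, h_A becomes an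
asymptotic cost (`peierls_le_iff`), and calibration becomes u(x) = min over shift w = x of u(w) +
φ(w) (`isCalibrated_iff`).

Uniform measures on periodic orbits lift to holonomic measures, so φ has nonnegative sums over
periodic orbits. Closing up segments by connecting words of bounded length, all Birkhoff sums are
bounded below. Hence the barrier from a point of Ω(A) is finite; it satisfies the triangle
inequality, vanishes on the diagonal over Ω(A), and is calibrated in its second variable
(`isCalibratedFor_barrier`). Finite minima of calibrated functions are calibrated, which gives
existence.

For the representation, follow a calibrated backward orbit of x. It accumulates at some q in Ω(A)
with u(x) - u(q) ≥ h_A(q, x) (`IsCalibratedFor.exists_isNonWandering`). This q lies in some C_i, and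
equivalence with the chosen point of C_i transfers the bound to that point. Uniqueness follows. -/

namespace HolonomicModel

variable {s : ℕ} {M : Matrix (Fin s) (Fin s) ℤ}

/-! ### The one-sided shift -/

/-- The one-sided shift map. -/
def shift (x : Shift M) : Shift M := ⟨fun n => x.1 (n + 1), fun j => x.2 (j + 1)⟩

theorem shift_iterate_apply (x : Shift M) (k j : ℕ) : (shift^[k] x).1 j = x.1 (j + k) := by
  induction k generalizing x with
  | zero => rfl
  | succ k ih => rw [Function.iterate_succ_apply, ih]; rfl

theorem shift_tau (z : NatExt M) : shift (tau z) = proj z := rfl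

/-- Agreement of the first `N` coordinates. -/
def Agree (N : ℕ) (x y : Shift M) : Prop := ∀ j < N, x.1 j = y.1 j

namespace Agree

variable {N m k : ℕ} {x y z : Shift M}

theorem refl (N : ℕ) (x : Shift M) : Agree N x x := fun _ _ => rfl

theorem symm (h : Agree N x y) : Agree N y x := fun j hj => (h j hj).symm

theorem trans (h : Agree N x y) (h' : Agree N y z) : Agree N x z :=
  fun j hj => (h j hj).trans (h' j hj)

theorem mono (h : Agree N x y) (hm : m ≤ N) : Agree m x y := fun j hj => h j (hj.trans_le hm)

theorem shift_iterate (h : Agree (N + k) x y) : Agree N (shift^[k] x) (shift^[k] y) := by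
  intro j hj
  rw [shift_iterate_apply, shift_iterate_apply]
  exact h _ (by omega)

theorem append (h : Agree k x y) (h' : Agree N (shift^[k] x) (shift^[k] y)) :
    Agree (k + N) x y := by
  intro j hj
  rcases lt_or_ge j k with hjk | hjk
  · exact h j hjk
  · have := h' (j - k) (by omega)
    rw [shift_iterate_apply, shift_iterate_apply] at this
    rwa [Nat.sub_add_cancel hjk] at this

end Agree

theorem continuous_coord {P : (ℕ → Fin s) → Prop} (j : ℕ) :
    Continuous fun x : {x : ℕ → Fin s // P x} => x.1 j :=
  (continuous_apply j).comp continuous_subtype_val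

theorem isClosed_shift_carrier : IsClosed {x : ℕ → Fin s | ∀ j, M (x j) (x (j + 1)) = 1} := by
  simp only [ofPred_forall]
  refine isClosed_iInter fun j => ?_
  have hj : Continuous fun x : ℕ → Fin s => (x j, x (j + 1)) := by fun_prop
  have hc : Continuous fun x : ℕ → Fin s => M (x j) (x (j + 1)) :=
    (continuous_of_discreteTopology (f := fun q : Fin s × Fin s => M q.1 q.2)).comp hj
  exact isClosed_eq hc continuous_const

theorem isClosed_dualShift_carrier : IsClosed {x : ℕ → Fin s | ∀ j, M (x (j + 1)) (x j) = 1} :=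
  isClosed_shift_carrier (M := M.transpose)

instance : SecondCountableTopology (Shift M) :=
  Topology.IsEmbedding.subtypeVal.secondCountableTopology

instance : SecondCountableTopology (DualShift M) :=
  Topology.IsEmbedding.subtypeVal.secondCountableTopology

instance : SecondCountableTopology (NatExt M) :=
  Topology.IsEmbedding.subtypeVal.secondCountableTopology

instance : CompactSpace (Shift M) := isCompact_iff_compactSpace.1 isClosed_shift_carrier.isCompact

instance : CompactSpace (DualShift M) :=
  isCompact_iff_compactSpace.1 isClosed_dualShift_carrier.isCompact

instance : CompactSpace (NatExt M) := by
  refine isCompact_iff_compactSpace.1 (IsClosed.isCompact ?_)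
  have hc : Continuous fun z : DualShift M × Shift M => M (z.1.1 0) (z.2.1 0) :=
    (continuous_of_discreteTopology (f := fun q : Fin s × Fin s => M q.1 q.2)).comp
      (((continuous_coord 0).comp continuous_fst).prodMk ((continuous_coord 0).comp continuous_snd))
  exact isClosed_eq hc continuous_const

theorem eventually_agree (N : ℕ) (x : Shift M) : ∀ᶠ y in 𝓝 x, Agree N y x := by
  have : ∀ᶠ y in 𝓝 x, ∀ j ∈ Finset.range N, y.1 j = x.1 j := by
    rw [Filter.eventually_all_finset]
    intro j _
    have hc : ContinuousAt (fun y : Shift M => y.1 j) x := (continuous_coord j).continuousAt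
    exact hc.eventually (eventually_of_mem (mem_nhds_discrete.2 (mem_singleton (x.1 j)))
      fun _ h => h)
  exact this.mono fun y hy j hj => hy j (Finset.mem_range.2 hj)

theorem continuous_shift : Continuous (shift : Shift M → Shift M) := by
  exact Continuous.subtype_mk (continuous_pi fun n => continuous_coord (n + 1)) _

theorem continuous_proj : Continuous (proj : NatExt M → Shift M) := by
  unfold proj; fun_prop

theorem continuous_tau : Continuous (tau : NatExt M → Shift M) := by
  refine Continuous.subtype_mk (continuous_pi fun n => ?_) _
  cases n with
  | zero => exact (continuous_coord 0).comp (continuous_fst.comp continuous_subtype_val)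
  | succ m => exact (continuous_coord m).comp (continuous_snd.comp continuous_subtype_val)

theorem tendsto_of_agree {x : ℕ → Shift M} {y : Shift M}
    (h : ∀ n, Agree n (x n) y) : Tendsto x atTop (𝓝 y) := by
  rw [tendsto_subtype_rng, tendsto_pi_nhds]
  intro j
  refine tendsto_const_nhds.congr' ?_
  filter_upwards [eventually_gt_atTop j] with n hn
  exact (h n j hn).symm

/-- The cylinders around `x` form a basis of neighborhoods. -/
theorem exists_agree_of_eventually {P : Shift M → Prop} {x : Shift M} (h : ∀ᶠ y in 𝓝 x, P y) :
    ∃ N, ∀ y, Agree N y x → P y := by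
  by_contra! hne
  choose y hy hP using hne
  obtain ⟨n, hn⟩ := ((tendsto_of_agree hy).eventually h).exists
  exact hP n hn

/-- Replace the coordinates of `w` from the `k`-th one on by `w'`. -/
theorem exists_splice (w w' : Shift M) (k : ℕ) (h : Agree 1 (shift^[k] w) w') :
    ∃ v : Shift M, Agree k v w ∧ shift^[k] v = w' := by
  have h0 : w.1 k = w'.1 0 := by
    have := h 0 one_pos
    rwa [shift_iterate_apply, zero_add] at this
  refine ⟨⟨fun j => if j < k then w.1 j else w'.1 (j - k), fun j => ?_⟩, fun j hj => ?_, ?_⟩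
  · change M (if j < k then w.1 j else w'.1 (j - k))
      (if j + 1 < k then w.1 (j + 1) else w'.1 (j + 1 - k)) = 1
    rcases lt_trichotomy (j + 1) k with hj | hj | hj
    · simp only [hj, if_true, (Nat.lt_succ_self j).trans hj]; exact w.2 j
    · subst hj
      simp only [Nat.lt_succ_self, if_true, lt_irrefl, if_false, Nat.sub_self, ← h0]
      exact w.2 j
    · rw [if_neg (by omega), if_neg (by omega), show j + 1 - k = j - k + 1 by omega]
      exact w'.2 _
  · exact if_pos hj
  · refine Subtype.ext (funext fun j => ?_)
    rw [shift_iterate_apply]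
    simp

/-- Close up a segment with equal initial and final symbol to a periodic orbit. -/
theorem exists_periodic (w : Shift M) {k : ℕ} (hk : 0 < k) (h : w.1 k = w.1 0) :
    ∃ q : Shift M, Agree k q w ∧ shift^[k] q = q := by
  refine ⟨⟨fun j => w.1 (j % k), fun j => ?_⟩, fun j hj => ?_, ?_⟩
  · change M (w.1 (j % k)) (w.1 ((j + 1) % k)) = 1
    have := w.2 (j % k)
    have hlt := Nat.mod_lt j hk
    rw [Nat.add_mod]
    rcases Nat.lt_or_ge 1 k with h1 | h1
    · rw [Nat.mod_eq_of_lt h1]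
      rcases Nat.lt_or_ge (j % k + 1) k with h2 | h2
      · rwa [Nat.mod_eq_of_lt h2]
      · have h3 : j % k + 1 = k := by omega
        rw [h3, h] at this
        rwa [h3, Nat.mod_self]
    · obtain rfl : k = 1 := by omega
      simp only [Nat.mod_one] at this ⊢
      simpa [h] using this
  · exact congrArg w.1 (Nat.mod_eq_of_lt hj)
  · refine Subtype.ext (funext fun j => ?_)
    rw [shift_iterate_apply]
    simp

/-- Transitivity of the shift with connecting words of length at most `m₀`. -/
def IsTransitive (M : Matrix (Fin s) (Fin s) ℤ) (m₀ : ℕ) : Prop :=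
  ∀ (a : Fin s) (x : Shift M), ∃ m, 1 ≤ m ∧ m ≤ m₀ ∧ ∃ w : Shift M, w.1 0 = a ∧ shift^[m] w = x

theorem exists_prepend {a : Fin s} {x : Shift M} (h : M a (x.1 0) = 1) :
    ∃ w : Shift M, w.1 0 = a ∧ shift w = x := by
  refine ⟨⟨fun n => Nat.casesOn n a fun m => x.1 m, fun j => ?_⟩, rfl, rfl⟩
  cases j with
  | zero => exact h
  | succ m => exact x.2 m

/-- Irreducibility supplies a path of positive length between any two symbols; the sum of the
lengths over all pairs bounds each of them. -/
theorem exists_isTransitive (hM01 : ∀ i j, M i j = 0 ∨ M i j = 1) (hM : M.IsIrreducible) :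
    ∃ m₀, IsTransitive M m₀ := by
  let _ := M.toQuiver
  have key : ∀ (a b : Fin s) (p : Quiver.Path a b) (x : Shift M), x.1 0 = b →
      ∃ w : Shift M, w.1 0 = a ∧ shift^[p.length] w = x := by
    intro a b p
    induction p with
    | nil => exact fun x hx => ⟨x, hx, rfl⟩
    | cons p e ih =>
      rename_i c d
      intro x hx
      have he : M c d = 1 := (hM01 c d).resolve_left (ne_of_gt (PLift.down e))
      obtain ⟨w, hw, hwx⟩ := exists_prepend (a := c) (x := x) (by rw [hx, he])
      obtain ⟨v, hv, hvw⟩ := ih w hw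
      refine ⟨v, hv, ?_⟩
      rw [Quiver.Path.length_cons, Function.iterate_succ_apply', hvw, hwx]
  choose p hp using hM.connected
  refine ⟨∑ a, ∑ b, (p a b).length, fun a x => ⟨(p a (x.1 0)).length, hp _ _, ?_, key _ _ _ x rfl⟩⟩
  calc (p a (x.1 0)).length ≤ ∑ b, (p a b).length :=
        Finset.single_le_sum (f := fun b => (p a b).length) (fun _ _ => Nat.zero_le _)
          (Finset.mem_univ _)
    _ ≤ _ := Finset.single_le_sum (f := fun a => ∑ b, (p a b).length) (fun _ _ => Nat.zero_le _)
          (Finset.mem_univ a)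

end HolonomicModel

namespace HolonomicModel

variable {s : ℕ} {M : Matrix (Fin s) (Fin s) ℤ}

/-! ### Potentials with exponentially small variation -/

/-- The variation of `φ` on cylinders of length `n + 1` is at most `K * ρ ^ n`. -/
structure HasExpVariation (φ : Shift M → ℝ) (K ρ : ℝ) : Prop where
  const_nonneg : 0 ≤ K
  rate_nonneg : 0 ≤ ρ
  rate_lt_one : ρ < 1
  abs_sub_le : ∀ n w w', Agree (n + 1) w w' → |φ w - φ w'| ≤ K * ρ ^ n

variable {φ : Shift M → ℝ} {K ρ : ℝ}

namespace HasExpVariation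

theorem continuous (h : HasExpVariation φ K ρ) : Continuous φ := by
  refine continuous_iff_continuousAt.2 fun x => Metric.tendsto_nhds.2 fun ε hε => ?_
  have hlim : Tendsto (fun n => K * ρ ^ n) atTop (𝓝 0) := by
    simpa using (tendsto_pow_atTop_nhds_zero_of_lt_one h.rate_nonneg h.rate_lt_one).const_mul K
  obtain ⟨n, hn⟩ := (hlim.eventually (gt_mem_nhds hε)).exists
  filter_upwards [eventually_agree (n + 1) x] with y hy
  exact (h.abs_sub_le n y x hy).trans_lt hn

theorem exists_abs_le (h : HasExpVariation φ K ρ) : ∃ Φ, 0 ≤ Φ ∧ ∀ w, |φ w| ≤ Φ := by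
  obtain ⟨C, hC⟩ := (isCompact_univ (X := Shift M)).exists_bound_of_continuousOn
    h.continuous.continuousOn
  exact ⟨max C 0, le_max_right _ _, fun w => (hC w (mem_univ w)).trans (le_max_left _ _)⟩

/-- Bounded distortion: the `i`-th iterates still agree on `k + N - i` coordinates, so the errors
form a geometric series, bounded independently of `k`. -/
theorem abs_birkhoffSum_sub_le (h : HasExpVariation φ K ρ) {k N : ℕ} {w w' : Shift M}
    (hw : Agree (k + N) w w') :
    |birkhoffSum shift φ k w - birkhoffSum shift φ k w'| ≤ K / (1 - ρ) * ρ ^ N := by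
  have h1 : 0 < 1 - ρ := sub_pos.2 h.rate_lt_one
  have key : ∀ i ∈ Finset.range k, |φ (shift^[i] w) - φ (shift^[i] w')| ≤
      K * ρ ^ N * ρ ^ (k - 1 - i) := by
    intro i hi
    rw [Finset.mem_range] at hi
    rw [mul_assoc, ← pow_add]
    refine h.abs_sub_le _ _ _ (Agree.shift_iterate (hw.mono (by omega)))
  have hgeom : ∑ i ∈ Finset.range k, ρ ^ i ≤ (1 - ρ)⁻¹ := by
    rw [← tsum_geometric_of_lt_one h.rate_nonneg h.rate_lt_one]
    exact (summable_geometric_of_lt_one h.rate_nonneg h.rate_lt_one).sum_le_tsum _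
      fun i _ => pow_nonneg h.rate_nonneg i
  unfold birkhoffSum
  rw [← Finset.sum_sub_distrib]
  refine (Finset.abs_sum_le_sum_abs _ _).trans ((Finset.sum_le_sum key).trans ?_)
  rw [← Finset.mul_sum, Finset.sum_range_reflect (fun i => ρ ^ i) k]
  calc K * ρ ^ N * ∑ i ∈ Finset.range k, ρ ^ i ≤ K * ρ ^ N * (1 - ρ)⁻¹ :=
        mul_le_mul_of_nonneg_left hgeom (mul_nonneg h.const_nonneg (pow_nonneg h.rate_nonneg N))
    _ = K / (1 - ρ) * ρ ^ N := by ring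

theorem distortion_nonneg (h : HasExpVariation φ K ρ) : 0 ≤ K / (1 - ρ) :=
  div_nonneg h.const_nonneg (sub_nonneg.2 h.rate_lt_one.le)

theorem exists_distortion_lt (h : HasExpVariation φ K ρ) {δ : ℝ} (hδ : 0 < δ) :
    ∃ N, 1 ≤ N ∧ K / (1 - ρ) * ρ ^ N < δ := by
  have hlim : Tendsto (fun n => K / (1 - ρ) * ρ ^ n) atTop (𝓝 0) := by
    simpa using (tendsto_pow_atTop_nhds_zero_of_lt_one h.rate_nonneg h.rate_lt_one).const_mul
      (K / (1 - ρ))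
  obtain ⟨n, hn, hn1⟩ :=
    ((hlim.eventually (gt_mem_nhds hδ)).and (eventually_ge_atTop 1)).exists
  exact ⟨n, hn1, hn⟩

end HasExpVariation

theorem abs_birkhoffSum_le {Φ : ℝ} (hΦ : ∀ w, |φ w| ≤ Φ) (k : ℕ) (w : Shift M) :
    |birkhoffSum shift φ k w| ≤ k * Φ := by
  refine (Finset.abs_sum_le_sum_abs _ _).trans ((Finset.sum_le_sum fun i _ => hΦ _).trans ?_)
  simp

/-- If the sums over periodic orbits are nonnegative, then all Birkhoff sums are bounded below. -/
theorem HasExpVariation.exists_le_birkhoffSum (h : HasExpVariation φ K ρ) {m₀ : ℕ}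
    (hM : IsTransitive M m₀)
    (hper : ∀ n q, 0 < n → shift^[n] q = q → 0 ≤ birkhoffSum shift φ n q) :
    ∃ L, 0 ≤ L ∧ ∀ k w, -L ≤ birkhoffSum shift φ k w := by
  obtain ⟨Φ, hΦ0, hΦ⟩ := h.exists_abs_le
  -- The connecting word costs at most `m₀ * Φ`; the two distortion terms compare the periodic point
  -- `q` with `v`, and `v` with `w`.
  refine ⟨m₀ * Φ + (K / (1 - ρ) + K / (1 - ρ)),
    add_nonneg (by positivity) (add_nonneg h.distortion_nonneg h.distortion_nonneg), fun k w => ?_⟩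
  have hD := h.distortion_nonneg
  rcases Nat.eq_zero_or_pos k with rfl | hk
  · rw [birkhoffSum_zero]
    have : 0 ≤ (m₀ : ℝ) * Φ := by positivity
    linarith
  -- After `k` steps along `w`, a connecting word leads back to `w` itself, so the resulting segment
  -- of length `k + m` closes up.
  obtain ⟨m, hm1, hm, w', hw'0, hw'⟩ := hM (w.1 k) w
  obtain ⟨v, hv, hvw⟩ := exists_splice w w' k fun j hj => by
    obtain rfl : j = 0 := by omega
    rw [shift_iterate_apply, hw'0, zero_add]
  have hper0 : v.1 (k + m) = v.1 0 := by
    rw [hv 0 hk, ← zero_add (k + m), ← shift_iterate_apply, add_comm k m,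
      Function.iterate_add_apply, hvw, hw']
  obtain ⟨q, hq, hqq⟩ := exists_periodic v (by omega) hper0
  have h0 := hper (k + m) q (by omega) hqq
  rw [birkhoffSum_add] at h0
  have h1 := abs_le.1 (abs_birkhoffSum_le hΦ m (shift^[k] q))
  have h2 := abs_le.1 (h.abs_birkhoffSum_sub_le (k := k) (N := 0) (hq.mono (by omega)))
  have h3 := abs_le.1 (h.abs_birkhoffSum_sub_le (k := k) (N := 0) hv)
  have h4 : (m : ℝ) * Φ ≤ m₀ * Φ := by gcongr
  rw [pow_zero, mul_one] at h2 h3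
  linarith [h1.2, h2.2, h3.2]

/-! ### Asymptotic costs -/

/-- There are arbitrarily long orbit segments from `x` to `x'`, up to arbitrarily small errors,
of cost at most `c`, up to an arbitrarily small error. -/
def CostLE (φ : Shift M → ℝ) (x x' : Shift M) (c : ℝ) : Prop :=
  ∀ (N n : ℕ) (δ : ℝ), 0 < δ → ∃ k, n ≤ k ∧ ∃ w, Agree N w x ∧ Agree N (shift^[k] w) x' ∧
    birkhoffSum shift φ k w < c + δ

/-- Recurrence with vanishing cost. -/
def IsNonWandering (φ : Shift M → ℝ) (x : Shift M) : Prop :=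
  ∀ (N : ℕ) (δ : ℝ), 0 < δ → ∃ k, 1 ≤ k ∧ ∃ w, Agree N w x ∧ Agree N (shift^[k] w) x ∧
    |birkhoffSum shift φ k w| < δ

/-- Recurrence with asymptotically nonpositive cost. -/
def IsRecurrent (φ : Shift M → ℝ) (x : Shift M) : Prop :=
  ∀ (N : ℕ) (δ : ℝ), 0 < δ → ∃ k, 1 ≤ k ∧ ∃ w, Agree N w x ∧ Agree N (shift^[k] w) x ∧
    birkhoffSum shift φ k w < δ

/-- A uniform lower bound for Birkhoff sums. -/
def SumsBoundedBelow (φ : Shift M → ℝ) (L : ℝ) : Prop :=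
  ∀ k w, -L ≤ birkhoffSum shift φ k w

variable {x x' y z : Shift M} {a b c L : ℝ}

theorem CostLE.mono (h : CostLE φ x x' a) (hab : a ≤ b) : CostLE φ x x' b := fun N n δ hδ => by
  obtain ⟨k, hk, w, h1, h2, h3⟩ := h N n δ hδ
  exact ⟨k, hk, w, h1, h2, by linarith⟩

theorem costLE_of_forall_lt (h : ∀ b, a < b → CostLE φ x x' b) : CostLE φ x x' a :=
  fun N n δ hδ => by
    obtain ⟨k, hk, w, h1, h2, h3⟩ := h (a + δ / 2) (by linarith) N n (δ / 2) (by linarith)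
    exact ⟨k, hk, w, h1, h2, by linarith⟩

theorem CostLE.neg_le (h : CostLE φ x x' c) (hL : SumsBoundedBelow φ L) : -L ≤ c := by
  refine le_of_forall_pos_lt_add fun δ hδ => ?_
  obtain ⟨k, -, w, -, -, h3⟩ := h 0 0 δ hδ
  exact (hL k w).trans_lt h3

/-- Costs of concatenated segments add up to a small error. Only the first segment is perturbed,
since `q` follows `w` exactly from time `k` on. -/
theorem HasExpVariation.exists_concat (h : HasExpVariation φ K ρ) {k l N : ℕ} (hN : 1 ≤ N)
    {v w : Shift M} (hvw : Agree N (shift^[k] v) w) :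
    ∃ q, Agree (k + N) q v ∧ shift^[k] q = w ∧
      birkhoffSum shift φ (k + l) q ≤ birkhoffSum shift φ k v + K / (1 - ρ) * ρ ^ N +
        birkhoffSum shift φ l w := by
  obtain ⟨q, hq, hqw⟩ := exists_splice v w k (hvw.mono hN)
  have hag : Agree (k + N) q v := hq.append (by rw [hqw]; exact hvw.symm)
  refine ⟨q, hag, hqw, ?_⟩
  rw [birkhoffSum_add, hqw]
  linarith [(abs_le.1 (h.abs_birkhoffSum_sub_le hag)).2]

theorem CostLE.trans (hφ : HasExpVariation φ K ρ) (h : CostLE φ x y a) (h' : CostLE φ y z b) :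
    CostLE φ x z (a + b) := fun N n δ hδ => by
  obtain ⟨N₀, hN₀, hδ'⟩ := hφ.exists_distortion_lt (δ := δ / 3) (by linarith)
  -- Length at least `N` ensures that the splice at time `k` leaves the first `N` coordinates
  -- untouched.
  obtain ⟨k, hk, v, v1, v2, v3⟩ := h (max N N₀) (max n N) (δ / 3) (by linarith)
  obtain ⟨l, hl, w, w1, w2, w3⟩ := h' (max N N₀) n (δ / 3) (by linarith)
  obtain ⟨q, q1, q2, q3⟩ := hφ.exists_concat (l := l) hN₀
    ((v2.trans w1.symm).mono (le_max_right N N₀))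
  refine ⟨k + l, by omega, q, (q1.mono (by omega)).trans (v1.mono (le_max_left _ _)), ?_, ?_⟩
  · rw [add_comm, Function.iterate_add_apply, q2]
    exact w2.mono (le_max_left _ _)
  · linarith

/-- Recurrence only promises a return time of at least `1`; concatenating cheap returns makes the
time as long as desired. -/
theorem IsRecurrent.costLE_self (hφ : HasExpVariation φ K ρ) (h : IsRecurrent φ x) :
    CostLE φ x x 0 := by
  have key : ∀ n N (δ : ℝ), 0 < δ → ∃ k, n ≤ k ∧ ∃ w, Agree N w x ∧ Agree N (shift^[k] w) x ∧
      birkhoffSum shift φ k w < δ := by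
    intro n
    induction n with
    | zero =>
      intro N δ hδ
      obtain ⟨k, -, w, h1, h2, h3⟩ := h N δ hδ
      exact ⟨k, Nat.zero_le k, w, h1, h2, h3⟩
    | succ n ih =>
      intro N δ hδ
      obtain ⟨N₀, hN₀, hδ'⟩ := hφ.exists_distortion_lt (δ := δ / 3) (by linarith)
      obtain ⟨k, hk, v, v1, v2, v3⟩ := ih (max N N₀) (δ / 3) (by linarith)
      obtain ⟨l, hl, w, w1, w2, w3⟩ := h (max N N₀) (δ / 3) (by linarith)
      -- Here `k` may be smaller than `N`, so the agreement of `q` with `v` on `N` coordinates must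
      -- come from the overlap `max N N₀`.
      obtain ⟨q, q1, q2, q3⟩ := hφ.exists_concat (l := l) (N := max N N₀) (by omega)
        (v2.trans w1.symm)
      have hD : K / (1 - ρ) * ρ ^ (max N N₀) ≤ K / (1 - ρ) * ρ ^ N₀ :=
        mul_le_mul_of_nonneg_left
          (pow_le_pow_of_le_one hφ.rate_nonneg hφ.rate_lt_one.le (le_max_right _ _))
          hφ.distortion_nonneg
      refine ⟨k + l, by omega, q, (q1.mono (by omega)).trans (v1.mono (le_max_left _ _)), ?_, ?_⟩
      · rw [add_comm, Function.iterate_add_apply, q2]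
        exact w2.mono (le_max_left _ _)
      · linarith
  intro N n δ hδ
  simpa using key n N δ hδ

/-- Return to `x` at negligible cost for as long as required, then take a connecting word to `y`.
The exponent `1` reflects that only one symbol matches at the junction. -/
theorem IsRecurrent.exists_costLE (hφ : HasExpVariation φ K ρ) {m₀ : ℕ}
    (hM : IsTransitive M m₀) (h : IsRecurrent φ x) (y : Shift M) : ∃ c, CostLE φ x y c := by
  obtain ⟨Φ, hΦ0, hΦ⟩ := hφ.exists_abs_le
  refine ⟨K / (1 - ρ) * ρ ^ 1 + m₀ * Φ, fun N n δ hδ => ?_⟩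
  obtain ⟨k, hk, v, v1, v2, v3⟩ := h.costLE_self hφ (N + 1) (max N n) δ hδ
  obtain ⟨m, -, hm, w, w0, hw⟩ := hM (x.1 0) y
  obtain ⟨q, q1, q2, q3⟩ := hφ.exists_concat (k := k) (l := m) (v := v) (w := w) le_rfl
    fun j hj => by
      obtain rfl : j = 0 := by omega
      rw [v2 0 (Nat.succ_pos N), w0]
  refine ⟨k + m, by omega, q, (q1.mono (by omega)).trans (v1.mono (Nat.le_succ N)), ?_, ?_⟩
  · rw [add_comm, Function.iterate_add_apply, q2, hw]
    exact Agree.refl _ _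
  · have h1 := (abs_le.1 (abs_birkhoffSum_le hΦ m w)).2
    have h4 : (m : ℝ) * Φ ≤ m₀ * Φ := by gcongr
    linarith

/-- Redirecting the end of a segment from `y` to `z` costs only the distortion. This yields
continuity of the barrier in its second variable. -/
theorem CostLE.of_agree (hφ : HasExpVariation φ K ρ) {N : ℕ} (hN : 1 ≤ N) (hyz : Agree N y z)
    (h : CostLE φ x y c) : CostLE φ x z (c + K / (1 - ρ) * ρ ^ N) := fun N' n δ hδ => by
  obtain ⟨k, hk, v, v1, v2, v3⟩ := h (max N' N) (max n N') δ hδ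
  obtain ⟨q, q1, q2, q3⟩ := hφ.exists_concat (l := 0) hN
    ((v2.mono (le_max_right N' N)).trans hyz)
  refine ⟨k, by omega, q, (q1.mono (by omega)).trans (v1.mono (le_max_left _ _)), ?_, ?_⟩
  · rw [q2]; exact Agree.refl _ _
  · rw [birkhoffSum_zero, add_zero] at q3
    linarith

theorem CostLE.step (hφ : HasExpVariation φ K ρ) (h : CostLE φ x y c) :
    CostLE φ x (shift y) (c + φ y) := fun N n δ hδ => by
  obtain ⟨N₀, hN₀⟩ := exists_agree_of_eventually (hφ.continuous.continuousAt.eventually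
    (gt_mem_nhds (show φ y < φ y + δ / 2 by linarith)))
  obtain ⟨k, hk, v, v1, v2, v3⟩ := h (max (N + 1) N₀) n (δ / 2) (by linarith)
  refine ⟨k + 1, by omega, v, v1.mono (by omega), ?_, ?_⟩
  · rw [Function.iterate_succ_apply']
    exact (v2.mono (le_max_left _ _)).shift_iterate (k := 1)
  · rw [birkhoffSum_succ]
    linarith [hN₀ _ (v2.mono (le_max_right _ _))]

/-- Drop the last step of ever better segments ending near `y`; by compactness their penultimate
points accumulate at a suitable `w`. -/
theorem CostLE.exists_preimage (hφ : HasExpVariation φ K ρ) (h : CostLE φ x y c) :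
    ∃ w, shift w = y ∧ CostLE φ x w (c - φ w) := by
  choose k hk v v1 v2 v3 using fun n : ℕ =>
    h n (n + 1) (1 / ((n : ℝ) + 1)) Nat.one_div_pos_of_nat
  obtain ⟨w, -, ψ, hψ, hlim⟩ := (isCompact_univ (X := Shift M)).tendsto_subseq
    (x := fun n => shift^[k n - 1] (v n)) fun _ => mem_univ _
  have hk' : ∀ n, shift (shift^[k n - 1] (v n)) =
      shift^[k n] (v n) := fun n => by
    rw [← Function.iterate_succ_apply' shift, Nat.succ_eq_add_one,
      Nat.sub_add_cancel ((Nat.le_add_left 1 n).trans (hk n))]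
  refine ⟨w, ?_, fun N n δ hδ => ?_⟩
  · refine tendsto_nhds_unique (continuous_shift.continuousAt.tendsto.comp hlim) ?_
    simp only [Function.comp_def, hk']
    exact (tendsto_of_agree v2).comp hψ.tendsto_atTop
  · have e1 := hlim.eventually (eventually_agree N w)
    have e2 := hlim.eventually (hφ.continuous.continuousAt.eventually
      (lt_mem_nhds (show φ w - δ / 2 < φ w by linarith)))
    have e3 := (tendsto_one_div_add_atTop_nhds_zero_nat (𝕜 := ℝ)).comp hψ.tendsto_atTop
    have e3 := e3.eventually (gt_mem_nhds (show (0 : ℝ) < δ / 2 by linarith))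
    have e4 := hψ.tendsto_atTop.eventually (eventually_ge_atTop (max n N))
    obtain ⟨j, j1, j2, j3, j4⟩ := (e1.and (e2.and (e3.and e4))).exists
    have hkj := hk (ψ j)
    refine ⟨k (ψ j) - 1, by omega, v (ψ j), (v1 (ψ j)).mono (by omega), j1, ?_⟩
    have := v3 (ψ j)
    rw [show k (ψ j) = k (ψ j) - 1 + 1 by omega, birkhoffSum_succ] at this
    simp only [Function.comp_apply] at j2 j3
    linarith

end HolonomicModel

namespace HolonomicModel

variable {s : ℕ} {M : Matrix (Fin s) (Fin s) ℤ}
variable {φ : Shift M → ℝ} {K ρ : ℝ} {x x' y z : Shift M} {a b c L : ℝ}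

/-! ### Existence of non-wandering points -/

/-- Pigeonhole along an orbit of small total cost: if the first `N` symbols and the partial sums
rounded to mesh `δ` coincide at two times, the segment between them is the required one. -/
theorem exists_recurrent_segment (hL : SumsBoundedBelow φ L)
    (hlow : ∀ k, ∃ w, birkhoffSum shift φ k w ≤ 1) (N : ℕ) {δ : ℝ} (hδ : 0 < δ) :
    ∃ k, 1 ≤ k ∧ ∃ w, Agree N (shift^[k] w) w ∧ |birkhoffSum shift φ k w| < δ := by
  classical
  let T : Finset ((Fin N → Fin s) × ℤ) :=
    Finset.univ ×ˢ Finset.Icc ⌊-L / δ⌋ ⌊(1 + L) / δ⌋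
  obtain ⟨w, hw⟩ := hlow T.card
  let f : ℕ → (Fin N → Fin s) × ℤ :=
    fun j => (fun i => (shift^[j] w).1 i, ⌊birkhoffSum shift φ j w / δ⌋)
  have hf : ∀ j ∈ Finset.range (T.card + 1), f j ∈ T := by
    intro j hj
    rw [Finset.mem_range] at hj
    -- The lower bound applied to the remaining segment bounds the partial sum from above by `1 +
    -- L`.
    have h1 := hL j w
    have h2 := hL (T.card - j) (shift^[j] w)
    have h3 := birkhoffSum_add shift φ j (T.card - j) w
    rw [show j + (T.card - j) = T.card by omega] at h3
    refine Finset.mem_product.2 ⟨Finset.mem_univ _, Finset.mem_Icc.2 ⟨?_, ?_⟩⟩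
    · exact Int.floor_le_floor (div_le_div_of_nonneg_right h1 hδ.le)
    · exact Int.floor_le_floor (div_le_div_of_nonneg_right (by linarith) hδ.le)
  have main : ∀ i j, i < j → f i = f j →
      ∃ k, 1 ≤ k ∧ ∃ w, Agree N (shift^[k] w) w ∧ |birkhoffSum shift φ k w| < δ := by
    intro i j hij hfij
    refine ⟨j - i, by omega, shift^[i] w, ?_, ?_⟩
    · rw [← Function.iterate_add_apply, Nat.sub_add_cancel hij.le]
      intro l hl
      exact (congrFun (congrArg Prod.fst hfij) ⟨l, hl⟩).symm
    · have h3 := birkhoffSum_add shift φ i (j - i) w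
      rw [show i + (j - i) = j by omega] at h3
      have h4 := Int.abs_sub_lt_one_of_floor_eq_floor (congrArg Prod.snd hfij)
      rw [← sub_div, abs_div, abs_of_pos hδ, div_lt_one hδ, abs_sub_comm] at h4
      rwa [h3, add_sub_cancel_left] at h4
  obtain ⟨i, -, j, -, hij, hfij⟩ := Finset.exists_ne_map_eq_of_card_lt_of_maps_to (t := T)
    (by rw [Finset.card_range]; exact Nat.lt_succ_self _) hf
  rcases lt_or_gt_of_ne hij with h | h
  · exact main i j h hfij
  · exact main j i h hfij.symm

theorem exists_isNonWandering (hL : SumsBoundedBelow φ L)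
    (hlow : ∀ k, ∃ w, birkhoffSum shift φ k w ≤ 1) : ∃ x, IsNonWandering φ x := by
  choose k hk w hw hS using fun n : ℕ => exists_recurrent_segment hL hlow n
    (δ := 1 / ((n : ℝ) + 1)) Nat.one_div_pos_of_nat
  obtain ⟨x, -, ψ, hψ, hlim⟩ := (isCompact_univ (X := Shift M)).tendsto_subseq
    (x := w) fun _ => mem_univ _
  refine ⟨x, fun N δ hδ => ?_⟩
  have e3 := (tendsto_one_div_add_atTop_nhds_zero_nat (𝕜 := ℝ)).comp hψ.tendsto_atTop
  obtain ⟨j, j1, j2, j3⟩ := ((hlim.eventually (eventually_agree N x)).and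
    ((e3.eventually (gt_mem_nhds hδ)).and
      (hψ.tendsto_atTop.eventually (eventually_ge_atTop N)))).exists
  exact ⟨k (ψ j), hk _, w (ψ j), j1, ((hw _).mono j3).trans j1, (hS _).trans j2⟩

/-! ### Calibrated functions for a one-sided potential -/

/-- Continuous solutions of `u x = min_{shift w = x} (u w + φ w)`. -/
structure IsCalibratedFor (φ : Shift M → ℝ) (u : Shift M → ℝ) : Prop where
  continuous : Continuous u
  le_add : ∀ w, u (shift w) ≤ u w + φ w
  exists_preimage : ∀ x, ∃ w, shift w = x ∧ u w + φ w ≤ u x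

namespace IsCalibratedFor

variable {u : Shift M → ℝ}

theorem sub_le_birkhoffSum (hu : IsCalibratedFor φ u) (k : ℕ) (w : Shift M) :
    u (shift^[k] w) - u w ≤ birkhoffSum shift φ k w := by
  induction k with
  | zero => simp
  | succ k ih =>
    rw [birkhoffSum_succ, Function.iterate_succ_apply']
    linarith [hu.le_add (shift^[k] w)]

/-- The telescoped inequality passes to the limit by continuity of `u` at both end points. -/
theorem sub_le_of_costLE (hu : IsCalibratedFor φ u) (h : CostLE φ x y c) : u y - u x ≤ c := by
  refine le_of_forall_pos_lt_add fun δ hδ => ?_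
  obtain ⟨N₁, h₁⟩ := exists_agree_of_eventually (hu.continuous.continuousAt.eventually
    (gt_mem_nhds (show u x < u x + δ / 3 by linarith)))
  obtain ⟨N₂, h₂⟩ := exists_agree_of_eventually (hu.continuous.continuousAt.eventually
    (lt_mem_nhds (show u y - δ / 3 < u y by linarith)))
  obtain ⟨k, -, w, w1, w2, w3⟩ := h (max N₁ N₂) 0 (δ / 3) (by linarith)
  have := hu.sub_le_birkhoffSum k w
  linarith [h₁ _ (w1.mono (le_max_left _ _)), h₂ _ (w2.mono (le_max_right _ _))]

theorem add_const (hu : IsCalibratedFor φ u) (c : ℝ) : IsCalibratedFor φ fun x => c + u x where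
  continuous := continuous_const.add hu.continuous
  le_add w := by linarith [hu.le_add w]
  exists_preimage x := by
    obtain ⟨w, h1, h2⟩ := hu.exists_preimage x
    exact ⟨w, h1, by linarith⟩

theorem inf' {ι : Type*} {t : Finset ι} (ht : t.Nonempty) {u : ι → Shift M → ℝ}
    (hu : ∀ i, IsCalibratedFor φ (u i)) : IsCalibratedFor φ fun x => t.inf' ht fun i => u i x where
  continuous := Continuous.finset_inf'_apply ht fun i _ => (hu i).continuous
  le_add w := by
    obtain ⟨i, hi, h⟩ := t.exists_mem_eq_inf' ht fun i => u i w
    rw [h]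
    exact (Finset.inf'_le _ hi).trans ((hu i).le_add w)
  exists_preimage x := by
    obtain ⟨i, hi, h⟩ := t.exists_mem_eq_inf' ht fun i => u i x
    obtain ⟨w, h1, h2⟩ := (hu i).exists_preimage x
    refine ⟨w, h1, ?_⟩
    rw [h]
    exact (add_le_add_left (Finset.inf'_le (fun i => u i w) hi) _).trans h2

/-- A calibrated backward orbit accumulates at non-wandering points. -/
theorem exists_isNonWandering (hu : IsCalibratedFor φ u) (x : Shift M) :
    ∃ q, IsNonWandering φ q ∧ CostLE φ q x (u x - u q) := by
  choose g hg hgu using hu.exists_preimage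
  have hg' : Function.RightInverse g shift := hg
  -- Along the optimal preimages chosen by `g` the calibration inequality is an equality, so the
  -- sums telescope exactly.
  have hsum : ∀ k y, birkhoffSum shift φ k (g^[k] y) = u y - u (g^[k] y) := by
    intro k
    induction k with
    | zero => simp
    | succ k ih =>
      intro y
      have h1 := hu.le_add (g (g^[k] y))
      have h2 := hgu (g^[k] y)
      rw [hg] at h1
      rw [birkhoffSum_succ', Function.iterate_succ_apply', hg, ih]
      linarith
  obtain ⟨q, -, ψ, hψ, hlim⟩ := (isCompact_univ (X := Shift M)).tendsto_subseq
    (x := fun n => g^[n] x) fun _ => mem_univ _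
  have hlimu : Tendsto (fun j => u (g^[ψ j] x)) atTop (𝓝 (u q)) :=
    (hu.continuous.tendsto q).comp hlim
  refine ⟨q, fun N δ hδ => ?_, fun N n δ hδ => ?_⟩
  · have e : ∀ᶠ j in atTop, Agree N (g^[ψ j] x) q ∧ |u (g^[ψ j] x) - u q| < δ / 2 :=
      (hlim.eventually (eventually_agree N q)).and
        (Metric.tendsto_nhds.1 hlimu (δ / 2) (by linarith))
    -- Two successive terms of the convergent subsequence bound an orbit segment that starts and
    -- ends near `q`.
    obtain ⟨j, ⟨j1, j2⟩, j3, j4⟩ := (e.and ((tendsto_add_atTop_nat 1).eventually e)).exists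
    have hlt : ψ j < ψ (j + 1) := hψ (Nat.lt_succ_self j)
    have hit : g^[ψ (j + 1)] x = g^[ψ (j + 1) - ψ j] (g^[ψ j] x) := by
      rw [← Function.iterate_add_apply, Nat.sub_add_cancel hlt.le]
    refine ⟨ψ (j + 1) - ψ j, by omega, g^[ψ (j + 1)] x, j3, ?_, ?_⟩
    · rw [hit, (hg'.iterate _) _]
      exact j1
    · have hs := hsum (ψ (j + 1) - ψ j) (g^[ψ j] x)
      rw [← hit] at hs
      rw [hs]
      rw [abs_lt] at *
      constructor <;> linarith
  · obtain ⟨j, j1, j2, j3⟩ := ((hlim.eventually (eventually_agree N q)).and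
      ((hlimu.eventually (lt_mem_nhds (show u q - δ < u q by linarith))).and
        (hψ.tendsto_atTop.eventually (eventually_ge_atTop n)))).exists
    refine ⟨ψ j, j3, g^[ψ j] x, j1, ?_, ?_⟩
    · rw [(hg'.iterate _) _]
      exact Agree.refl _ _
    · rw [hsum]
      linarith

end IsCalibratedFor

/-! ### The barrier of a one-sided potential -/

/-- The least asymptotic cost from `x` to `y`. -/
noncomputable def barrier (φ : Shift M → ℝ) (x y : Shift M) : ℝ := sInf {c | CostLE φ x y c}

theorem barrier_le (hL : SumsBoundedBelow φ L) (h : CostLE φ x y c) : barrier φ x y ≤ c :=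
  csInf_le ⟨-L, fun _ hc => CostLE.neg_le hc hL⟩ h

/-- The infimum is attained because `CostLE` tolerates arbitrarily small errors. The hypothesis
rules out the empty set, where `sInf` has the default value `0`. -/
theorem costLE_barrier (h : CostLE φ x y c) : CostLE φ x y (barrier φ x y) :=
  costLE_of_forall_lt fun _ hb => by
    obtain ⟨a, ha, hab⟩ := exists_lt_of_csInf_lt ⟨c, h⟩ hb
    exact CostLE.mono ha hab.le

theorem IsRecurrent.barrier_self (hφ : HasExpVariation φ K ρ) (hL : SumsBoundedBelow φ L)
    (h : IsRecurrent φ x) : barrier φ x x = 0 := by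
  have h0 := h.costLE_self hφ
  have h1 := barrier_le hL h0
  -- Concatenation makes the barrier at most twice itself, hence nonnegative.
  have h2 := barrier_le hL ((costLE_barrier h0).trans hφ (costLE_barrier h0))
  linarith

theorem isCalibratedFor_barrier (hφ : HasExpVariation φ K ρ)
    (hL : SumsBoundedBelow φ L) (hfin : ∀ y, CostLE φ x y (barrier φ x y)) :
    IsCalibratedFor φ (barrier φ x) where
  continuous := by
    refine continuous_iff_continuousAt.2 fun y => Metric.tendsto_nhds.2 fun ε hε => ?_
    obtain ⟨N, hN, hNε⟩ := hφ.exists_distortion_lt hε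
    filter_upwards [eventually_agree N y] with z hz
    have h1 := barrier_le hL ((hfin y).of_agree hφ hN hz.symm)
    have h2 := barrier_le hL ((hfin z).of_agree hφ hN hz)
    rw [Real.dist_eq, abs_lt]
    constructor <;> linarith
  le_add w := barrier_le hL ((hfin w).step hφ)
  exists_preimage y := by
    obtain ⟨w, h1, h2⟩ := (hfin y).exists_preimage hφ
    exact ⟨w, h1, by linarith [barrier_le hL h2]⟩

end HolonomicModel

namespace HolonomicModel

variable {s : ℕ} {M : Matrix (Fin s) (Fin s) ℤ}

/-! ### Reduction of the observable to a one-sided potential -/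

theorem seqDist_nonneg {lam : ℝ} (h0 : 0 < lam) (a b : ℕ → Fin s) : 0 ≤ seqDist lam a b := by
  unfold seqDist
  split_ifs
  · exact le_rfl
  · positivity

theorem seqDist_self (lam : ℝ) (a : ℕ → Fin s) : seqDist lam a a = 0 := if_pos rfl

theorem seqDist_le_pow {lam : ℝ} (h0 : 0 < lam) (h1 : lam < 1) {a b : ℕ → Fin s} {N : ℕ}
    (h : ∀ j < N, a j = b j) : seqDist lam a b ≤ lam ^ N := by
  unfold seqDist
  split_ifs with hab
  · positivity
  · refine pow_le_pow_of_le_one h0.le h1.le ?_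
    by_contra! hlt
    exact PiNat.apply_firstDiff_ne (E := fun _ => Fin s) hab (h _ hlt)

theorem agree_of_seqDist_lt {lam : ℝ} (h0 : 0 < lam) (h1 : lam < 1) {a b : Shift M} {N : ℕ}
    (h : seqDist lam a.1 b.1 < lam ^ N) : Agree N a b := by
  intro j hj
  unfold seqDist at h
  split_ifs at h with hab
  · rw [hab]
  · have := (pow_lt_pow_iff_right_of_lt_one₀ h0 h1).1 h
    exact PiNat.apply_eq_of_lt_firstDiff (E := fun _ => Fin s) (hj.trans this)

theorem exists_seqDist_lt {lam : ℝ} (h0 : 0 < lam) (h1 : lam < 1) {ε : ℝ} (hε : 0 < ε) :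
    ∃ N, ∀ a b : Shift M, Agree N a b → seqDist lam a.1 b.1 < ε := by
  obtain ⟨N, hN⟩ := exists_pow_lt_of_lt_one hε h1
  exact ⟨N, fun a b hab => (seqDist_le_pow h0 h1 hab).trans_lt hN⟩

theorem IsHolderObservable.continuous {lam : ℝ} (h0 : 0 < lam) (h1 : lam < 1)
    {A : NatExt M → ℝ} (hA : IsHolderObservable lam A) : Continuous A := by
  obtain ⟨θ, hθ, C, hC⟩ := hA
  refine continuous_iff_continuousAt.2 fun z => Metric.tendsto_nhds.2 fun ε hε => ?_
  have hlim : Tendsto (fun n : ℕ => |C| * (lam ^ n) ^ θ) atTop (𝓝 0) := by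
    have := ((tendsto_pow_atTop_nhds_zero_of_lt_one h0.le h1).rpow_const (p := θ)
      (Or.inr hθ.le)).const_mul |C|
    rwa [Real.zero_rpow hθ.ne', mul_zero] at this
  obtain ⟨N, hN⟩ := (hlim.eventually (gt_mem_nhds hε)).exists
  have hy : ContinuousAt (fun w : NatExt M => w.1.1) z :=
    (continuous_fst.comp continuous_subtype_val).continuousAt
  have hx : ContinuousAt (fun w : NatExt M => w.1.2) z :=
    (continuous_snd.comp continuous_subtype_val).continuousAt
  -- The dual shift is the shift of the transposed matrix.
  filter_upwards [hy.eventually (eventually_agree (M := M.transpose) N z.1.1),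
    hx.eventually (eventually_agree N z.1.2)] with w hwy hwx
  refine lt_of_le_of_lt ((hC w z).trans ?_) hN
  refine mul_le_mul (le_abs_self C) ?_ 
    (Real.rpow_nonneg (le_max_of_le_left (seqDist_nonneg h0 _ _)) _) (abs_nonneg C)
  exact Real.rpow_le_rpow (le_max_of_le_left (seqDist_nonneg h0 _ _))
    (max_le (seqDist_le_pow h0 h1 hwy) (seqDist_le_pow h0 h1 hwx)) hθ.le

/-- The point over `w` with the same past as `z`. -/
def withImage (z : NatExt M) (w : Shift M) (h : w.1 0 = z.1.1.1 0) : NatExt M :=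
  ⟨(z.1.1, shift w), by rw [← h]; exact w.2 0⟩

theorem tau_withImage (z : NatExt M) (w : Shift M) (h : w.1 0 = z.1.1.1 0) :
    tau (withImage z w h) = w := by
  refine Subtype.ext (funext fun j => ?_)
  cases j with
  | zero => exact h.symm
  | succ j => rfl

theorem shift_surjective {m₀ : ℕ} (hM : IsTransitive M m₀) :
    Function.Surjective (shift : Shift M → Shift M) := fun a => by
  obtain ⟨m, hm1, -, b, -, hb⟩ := hM (a.1 0) a
  exact ⟨shift^[m - 1] b, by
    rw [← Function.iterate_succ_apply' shift, Nat.succ_eq_add_one, Nat.sub_add_cancel hm1, hb]⟩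

/-- A past for `w` is built by iterating a right inverse of the shift. -/
theorem exists_tau_eq {m₀ : ℕ} (hM : IsTransitive M m₀) (w : Shift M) :
    ∃ z : NatExt M, tau z = w := by
  choose g hg using shift_surjective hM
  refine ⟨⟨(⟨fun n => (g^[n] w).1 0, fun j => ?_⟩, shift w), w.2 0⟩, ?_⟩
  · change M ((g^[j + 1] w).1 0) ((g^[j] w).1 0) = 1
    have h : shift (g^[j + 1] w) = g^[j] w := by rw [Function.iterate_succ_apply', hg]
    rw [← h]
    exact (g^[j + 1] w).2 0
  · refine Subtype.ext (funext fun j => ?_)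
    cases j <;> rfl

/-- The least value of `A` among the points of the natural extension over `w = τ_y(x)`. -/
noncomputable def fiberMin (A : NatExt M → ℝ) (w : Shift M) : ℝ := sInf (A '' (tau ⁻¹' {w}))

section fiberMin

variable {A : NatExt M → ℝ}

theorem fiberMin_tau_le (hA : Continuous A) (z : NatExt M) : fiberMin A (tau z) ≤ A z :=
  csInf_le (((isClosed_singleton.preimage continuous_tau).isCompact.image hA).bddBelow)
    (mem_image_of_mem A rfl)

theorem exists_fiberMin_eq {m₀ : ℕ} (hM : IsTransitive M m₀) (hA : Continuous A) (w : Shift M) :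
    ∃ z, tau z = w ∧ A z = fiberMin A w := by
  obtain ⟨z₀, hz₀⟩ := exists_tau_eq hM w
  obtain ⟨z, hz, h⟩ := ((isClosed_singleton.preimage continuous_tau).isCompact.image hA).sInf_mem
    ⟨A z₀, z₀, hz₀, rfl⟩
  exact ⟨z, hz, h⟩

/-- The normalized one-sided potential. -/
noncomputable def potential (A : NatExt M → ℝ) (w : Shift M) : ℝ := fiberMin A w - minValue A

/-- An optimal past for `w` is admissible for `w'`, as both have the same first symbol. Only the
futures `shift w` and `shift w'` differ, and they agree on `n` coordinates; hence the rate `lam ^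
θ`. -/
theorem exists_hasExpVariation_potential {lam : ℝ} (h0 : 0 < lam) (h1 : lam < 1) {m₀ : ℕ}
    (hM : IsTransitive M m₀) (hA : IsHolderObservable lam A) :
    ∃ K ρ, HasExpVariation (potential A) K ρ := by
  have hcont := hA.continuous h0 h1
  obtain ⟨θ, hθ, C, hC⟩ := hA
  have key : ∀ n (w w' : Shift M), Agree (n + 1) w w' →
      fiberMin A w' ≤ fiberMin A w + |C| * (lam ^ θ) ^ n := by
    intro n w w' h
    obtain ⟨z, hz, hzA⟩ := exists_fiberMin_eq hM hcont w
    subst hz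
    have hz0 : w'.1 0 = z.1.1.1 0 := (h 0 (Nat.succ_pos n)).symm
    have hx : seqDist lam (shift w').1 z.1.2.1 ≤ lam ^ n :=
      seqDist_le_pow h0 h1 fun j hj => (h (j + 1) (by omega)).symm
    have hd := hC (withImage z w' hz0) z
    have hle := fiberMin_tau_le hcont (withImage z w' hz0)
    rw [tau_withImage] at hle
    have hpow : (max (seqDist lam z.1.1.1 z.1.1.1) (seqDist lam (shift w').1 z.1.2.1)) ^ θ ≤
        (lam ^ θ) ^ n := by
      rw [← Real.rpow_natCast, ← Real.rpow_mul h0.le, mul_comm θ, Real.rpow_mul h0.le,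
        Real.rpow_natCast]
      refine Real.rpow_le_rpow (le_max_of_le_left (seqDist_nonneg h0 _ _)) ?_ hθ.le
      rw [seqDist_self]
      exact max_le (by positivity) hx
    have hmul : C * (max (seqDist lam z.1.1.1 z.1.1.1) (seqDist lam (shift w').1 z.1.2.1)) ^ θ ≤
        |C| * (lam ^ θ) ^ n :=
      mul_le_mul (le_abs_self C) hpow
        (Real.rpow_nonneg (le_max_of_le_left (seqDist_nonneg h0 _ _)) _) (abs_nonneg C)
    have habs := (abs_le.1 (hd.trans hmul)).2
    linarith
  refine ⟨|C|, lam ^ θ, abs_nonneg C, by positivity, Real.rpow_lt_one h0.le h1 hθ,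
    fun n w w' h => ?_⟩
  have := key n w w' h
  have := key n w' w h.symm
  unfold potential
  rw [abs_le]
  constructor <;> linarith

end fiberMin

end HolonomicModel

namespace HolonomicModel

variable {s : ℕ} {M : Matrix (Fin s) (Fin s) ℤ} {A : NatExt M → ℝ}

/-! ### Holonomic measures -/

theorem integrable_of_continuous {X : Type*} [TopologicalSpace X] [CompactSpace X]
    [SecondCountableTopology X] [MeasurableSpace X] [OpensMeasurableSpace X] {f : X → ℝ}
    (hf : Continuous f) (μ : Measure X) [IsFiniteMeasure μ] : Integrable f μ := by
  obtain ⟨C, hC⟩ := (isCompact_univ (X := X)).exists_bound_of_continuousOn hf.continuousOn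
  exact Integrable.of_bound hf.aestronglyMeasurable C (Eventually.of_forall fun x => hC x trivial)

theorem bddBelow_holonomic_integrals (hA : Continuous A) :
    BddBelow {a : ℝ | ∃ μ : Measure (NatExt M), IsHolonomic μ ∧ a = ∫ z, A z ∂μ} := by
  obtain ⟨C, hC⟩ := (isCompact_univ (X := NatExt M)).exists_bound_of_continuousOn hA.continuousOn
  refine ⟨-C, ?_⟩
  rintro a ⟨μ, ⟨hμ, -⟩, rfl⟩
  have := norm_integral_le_of_norm_le_const (μ := μ) (f := A) (C := C)
    (Eventually.of_forall fun x => hC x trivial)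
  rw [probReal_univ, mul_one] at this
  exact (abs_le.1 this).1

/-- The uniform measure on a finite family of points. -/
noncomputable def averageDirac (n : ℕ) (z : ℕ → NatExt M) : Measure (NatExt M) :=
  (n : ENNReal)⁻¹ • ∑ i ∈ Finset.range n, Measure.dirac (z i)

theorem integral_averageDirac (n : ℕ) (z : ℕ → NatExt M) {f : NatExt M → ℝ} (hf : Continuous f) :
    ∫ x, f x ∂averageDirac n z = (n : ℝ)⁻¹ * ∑ i ∈ Finset.range n, f (z i) := by
  unfold averageDirac
  rw [integral_smul_measure, integral_finsetSum_measure fun i _ => integrable_of_continuous hf _]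
  simp

/-- The two integrals average `f` over the orbit and over its shift by one step, which coincide by
periodicity. -/
theorem isHolonomic_averageDirac {n : ℕ} (hn : 0 < n) {q : Shift M} (hq : shift^[n] q = q)
    {z : ℕ → NatExt M} (hz : ∀ i, tau (z i) = shift^[i] q) : IsHolonomic (averageDirac n z) := by
  refine ⟨⟨?_⟩, fun f => ?_⟩
  · have : (n : ENNReal) ≠ 0 := by exact_mod_cast hn.ne'
    simp [averageDirac, ENNReal.inv_mul_cancel this (ENNReal.natCast_ne_top n)]
  · refine (integral_averageDirac n z (f.continuous.comp continuous_tau)).trans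
      (Eq.trans ?_ (integral_averageDirac n z (f.continuous.comp continuous_proj)).symm)
    congr 1
    have hp : ∀ i, f (proj (z i)) = f (shift^[i + 1] q) := fun i => by
      rw [← shift_tau, hz, Function.iterate_succ_apply']
    simp only [Function.comp_apply, hz, hp]
    have h1 := Finset.sum_range_succ (fun i => f (shift^[i] q)) n
    rw [Finset.sum_range_succ'] at h1
    simp only [hq, Function.iterate_zero_apply] at h1
    linarith

theorem birkhoffSum_potential (n : ℕ) (q : Shift M) : birkhoffSum shift (potential A) n q =
    ∑ i ∈ Finset.range n, fiberMin A (shift^[i] q) - n * minValue A := by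
  simp [birkhoffSum, potential, Finset.sum_sub_distrib]

theorem birkhoffSum_potential_nonneg_of_periodic {m₀ : ℕ} (hM : IsTransitive M m₀)
    (hA : Continuous A) (n : ℕ) (q : Shift M) (hn : 0 < n) (hq : shift^[n] q = q) :
    0 ≤ birkhoffSum shift (potential A) n q := by
  choose z hz hzA using fun i : ℕ => exists_fiberMin_eq hM hA (shift^[i] q)
  have h := csInf_le (bddBelow_holonomic_integrals hA)
    ⟨_, isHolonomic_averageDirac hn hq hz, rfl⟩
  change minValue A ≤ _ at h
  rw [integral_averageDirac n z hA] at h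
  have hn' : (0 : ℝ) < n := by exact_mod_cast hn
  rw [← div_eq_inv_mul, le_div_iff₀ hn'] at h
  simp only [hzA] at h
  rw [birkhoffSum_potential]
  linarith

theorem exists_isHolonomic {m₀ : ℕ} (hM : IsTransitive M m₀) (x : Shift M) :
    ∃ μ : Measure (NatExt M), IsHolonomic μ := by
  obtain ⟨m, hm, -, w, hw, hwx⟩ := hM (x.1 0) x
  obtain ⟨q, -, hq⟩ := exists_periodic w (k := m) hm (by
    rw [hw, ← hwx, shift_iterate_apply, zero_add])
  choose z hz using fun i : ℕ => exists_tau_eq hM (shift^[i] q)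
  exact ⟨_, isHolonomic_averageDirac hm hq hz⟩

/-- Minimality of `minValue A` gives orbit segments of small cost. -/
theorem exists_birkhoffSum_potential_le {m₀ : ℕ} (hM : IsTransitive M m₀) (hA : Continuous A)
    (hφ : Continuous (potential A)) (x : Shift M) (k : ℕ) :
    ∃ w, birkhoffSum shift (potential A) k w ≤ 1 := by
  obtain ⟨μ₀, hμ₀⟩ := exists_isHolonomic hM x
  -- An excess of `1 / (k + 1)` per step keeps the mean of a sum of `k` terms below `1`.
  have hk : (0 : ℝ) < 1 / (k + 1) := Nat.one_div_pos_of_nat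
  obtain ⟨a, ⟨μ, ⟨hμ, hhol⟩, rfl⟩, ha⟩ := exists_lt_of_csInf_lt
    (⟨_, μ₀, hμ₀, rfl⟩ : {a : ℝ | ∃ μ : Measure (NatExt M), IsHolonomic μ ∧
      a = ∫ z, A z ∂μ}.Nonempty)
    (show minValue A < minValue A + 1 / (k + 1) by linarith)
  -- Since `proj = shift ∘ tau`, holonomy says that the image of `μ` under `tau` is shift-invariant.
  have hinv : ∀ i, ∫ z, potential A (shift^[i] (tau z)) ∂μ = ∫ z, potential A (tau z) ∂μ := by
    intro i
    induction i with
    | zero => rfl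
    | succ i ih =>
      rw [← ih]
      exact (hhol ⟨_, hφ.comp (continuous_shift.iterate i)⟩).symm
  have hle : ∫ z, potential A (tau z) ∂μ ≤ ∫ z, (A z - minValue A) ∂μ :=
    integral_mono (integrable_of_continuous (hφ.comp continuous_tau) μ)
      (integrable_of_continuous (hA.sub continuous_const) μ)
      fun z => sub_le_sub_right (fiberMin_tau_le hA z) _
  rw [integral_sub (integrable_of_continuous hA μ) (integrable_const _), integral_const,
    probReal_univ, one_smul] at hle
  by_contra! hgt
  have hcont : ∀ i, Continuous fun z : NatExt M => potential A (shift^[i] (tau z)) := fun i =>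
    hφ.comp ((continuous_shift.iterate i).comp continuous_tau)
  have hone : (1 : ℝ) ≤ ∫ z, birkhoffSum shift (potential A) k (tau z) ∂μ := by
    have h := integral_mono (μ := μ) (integrable_const (1 : ℝ))
      (integrable_of_continuous (continuous_finsetSum (Finset.range k) fun i _ => hcont i) μ)
      fun z => (hgt (tau z)).le
    rw [integral_const, probReal_univ, one_smul] at h
    exact h
  unfold birkhoffSum at hone
  rw [integral_finsetSum _ fun i _ => integrable_of_continuous (hcont i) μ] at hone
  simp only [hinv, Finset.sum_const, Finset.card_range, nsmul_eq_mul] at hone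
  have h2 : (k : ℝ) * ∫ z, potential A (tau z) ∂μ ≤ k * (1 / (k + 1)) :=
    mul_le_mul_of_nonneg_left (by linarith) k.cast_nonneg
  have h3 : (k : ℝ) * (1 / (k + 1)) < 1 := by
    rw [mul_one_div, div_lt_one (by positivity)]
    linarith
  linarith

/-! ### Translation of the paths in the natural extension to orbit segments -/

theorem path_proj_eq {k : ℕ} {z : Fin (k + 1) → NatExt M}
    (hz : ∀ i : Fin k, proj (z i.castSucc) = tau (z i.succ)) (i : Fin (k + 1)) :
    proj (z i) = shift^[i] (proj (z 0)) := by
  induction i using Fin.induction with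
  | zero => rfl
  | succ i ih =>
    rw [← shift_tau, ← hz, ih, Fin.val_succ, Function.iterate_succ_apply']
    rfl

/-- The point `z (i + 1)` lies over the `i`-th iterate under `tau`; this is why the action omits `z
0`. -/
theorem birkhoffSum_le_action (hA : Continuous A) {k : ℕ} {z : Fin (k + 1) → NatExt M}
    (hz : ∀ i : Fin k, proj (z i.castSucc) = tau (z i.succ)) :
    birkhoffSum shift (potential A) k (proj (z 0)) ≤ action A z := by
  unfold birkhoffSum action
  rw [Finset.sum_range]
  refine Finset.sum_le_sum fun i _ => ?_
  have h := path_proj_eq hz i.castSucc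
  rw [hz] at h
  rw [Fin.val_castSucc] at h
  rw [← h]
  exact sub_le_sub_right (fiberMin_tau_le hA _) _

theorem exists_path {m₀ : ℕ} (hM : IsTransitive M m₀) (hA : Continuous A) (k : ℕ) (w : Shift M) :
    ∃ z : Fin (k + 1) → NatExt M, (∀ i : Fin k, proj (z i.castSucc) = tau (z i.succ)) ∧
      proj (z 0) = w ∧ proj (z (Fin.last k)) = shift^[k] w ∧
      action A z = birkhoffSum shift (potential A) k w := by
  -- The initial point must satisfy `proj (z 0) = w`, so the choice of fiber minimizers under `tau`
  -- starts one step earlier.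
  obtain ⟨w₀, hw₀⟩ := shift_surjective hM w
  choose z hz hzA using fun i : ℕ => exists_fiberMin_eq hM hA (shift^[i] w₀)
  have hproj : ∀ i, proj (z i) = shift^[i] w := fun i => by
    rw [← shift_tau, hz, ← Function.iterate_succ_apply' shift, Function.iterate_succ_apply, hw₀]
  have htau : ∀ i, tau (z (i + 1)) = shift^[i] w := fun i => by
    rw [hz, Function.iterate_succ_apply, hw₀]
  refine ⟨fun i => z i, fun i => ?_, hproj 0, hproj k, ?_⟩
  · exact (hproj i).trans (htau i).symm
  · unfold birkhoffSum action potential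
    rw [Finset.sum_range]
    refine Finset.sum_congr rfl fun i _ => ?_
    change A (z (i + 1)) - _ = _
    rw [hzA, Function.iterate_succ_apply, hw₀]

section

variable {lam : ℝ} {m₀ : ℕ} {x x' : Shift M}

theorem peierls_le_iff (h0 : 0 < lam) (h1 : lam < 1) (hM : IsTransitive M m₀) (hA : Continuous A)
    (c : ℝ) : peierls lam A x x' ≤ c ↔ CostLE (potential A) x x' c := by
  unfold peierls
  rw [iSup_le_iff]
  constructor
  · intro h N n δ hδ
    have h2 := (liminf_le_iff (by isBoundedDefault) (by isBoundedDefault)).1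
      (h ⟨lam ^ N, pow_pos h0 N⟩) ((c + δ : ℝ) : EReal)
      (EReal.coe_lt_coe_iff.2 (by linarith))
    obtain ⟨k, hk, h3⟩ := frequently_atTop.1 h2 n
    unfold minAction at h3
    simp only [iInf_lt_iff] at h3
    obtain ⟨z, ⟨z1, z2, z3⟩, z4⟩ := h3
    refine ⟨k, hk, proj (z 0), agree_of_seqDist_lt h0 h1 z2, ?_, ?_⟩
    · have := agree_of_seqDist_lt h0 h1 z3
      rwa [path_proj_eq z1, Fin.val_last] at this
    · exact (birkhoffSum_le_action hA z1).trans_lt (EReal.coe_lt_coe_iff.1 z4)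
  · rintro h ⟨ε, hε⟩
    refine (liminf_le_iff (by isBoundedDefault) (by isBoundedDefault)).2 fun b hb => ?_
    obtain ⟨d, hd, hdb⟩ := EReal.lt_iff_exists_real_btwn.1 hb
    have hd := EReal.coe_lt_coe_iff.1 hd
    obtain ⟨N, hN⟩ := exists_seqDist_lt (M := M) h0 h1 hε
    refine frequently_atTop.2 fun n => ?_
    obtain ⟨k, hk, w, w1, w2, w3⟩ := h N n (d - c) (by linarith)
    obtain ⟨z, z1, z2, z3, z4⟩ := exists_path hM hA k w
    refine ⟨k, hk, lt_of_le_of_lt (biInf_le _ ⟨z1, ?_, ?_⟩) (lt_of_le_of_lt ?_ hdb)⟩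
    · rw [z2]; exact hN _ _ w1
    · rw [z3]; exact hN _ _ w2
    · rw [z4]; exact EReal.coe_le_coe_iff.2 (by linarith)

theorem IsNonWandering.mem_nonWandering (h0 : 0 < lam) (h1 : lam < 1) (hM : IsTransitive M m₀)
    (hA : Continuous A) (h : IsNonWandering (potential A) x) : x ∈ nonWandering lam A := by
  intro ε hε
  obtain ⟨N, hN⟩ := exists_seqDist_lt (M := M) h0 h1 hε
  obtain ⟨k, hk, w, w1, w2, w3⟩ := h N ε hε
  obtain ⟨z, z1, z2, z3, z4⟩ := exists_path hM hA k w
  refine ⟨k, hk, z, ⟨z1, ?_, ?_⟩, by rwa [z4]⟩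
  · rw [z2]; exact hN _ _ w1
  · rw [z3]; exact hN _ _ w2

/-- The action only dominates the Birkhoff sum, so the absolute value is lost and a one-sided bound
remains; it suffices for finiteness of the barrier. -/
theorem isRecurrent_of_mem_nonWandering (h0 : 0 < lam) (h1 : lam < 1) (hA : Continuous A)
    (h : x ∈ nonWandering lam A) : IsRecurrent (potential A) x := by
  intro N δ hδ
  obtain ⟨k, hk, z, ⟨z1, z2, z3⟩, z4⟩ := h (min (lam ^ N) δ) (lt_min (pow_pos h0 N) hδ)
  refine ⟨k, hk, proj (z 0), agree_of_seqDist_lt h0 h1 (z2.trans_le (min_le_left _ _)), ?_, ?_⟩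
  · have := agree_of_seqDist_lt h0 h1 (z3.trans_le (min_le_left _ _))
    rwa [path_proj_eq z1, Fin.val_last] at this
  · exact (birkhoffSum_le_action hA z1).trans_lt
      ((le_abs_self _).trans_lt (z4.trans_le (min_le_right _ _)))

theorem coe_le_peierls (h0 : 0 < lam) (h1 : lam < 1) (hM : IsTransitive M m₀) (hA : Continuous A)
    {a : ℝ} (h : ∀ c, CostLE (potential A) x x' c → a ≤ c) : (a : EReal) ≤ peierls lam A x x' := by
  by_contra! hlt
  obtain ⟨c, hc, hca⟩ := EReal.lt_iff_exists_real_btwn.1 hlt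
  exact (h c ((peierls_le_iff h0 h1 hM hA c).1 hc.le)).not_gt (EReal.coe_lt_coe_iff.1 hca)

theorem peierls_eq_barrier (h0 : 0 < lam) (h1 : lam < 1) (hM : IsTransitive M m₀)
    (hA : Continuous A) {L : ℝ} (hL : SumsBoundedBelow (potential A) L)
    (h : CostLE (potential A) x x' (barrier (potential A) x x')) :
    peierls lam A x x' = barrier (potential A) x x' :=
  le_antisymm ((peierls_le_iff h0 h1 hM hA _).2 h)
    (coe_le_peierls h0 h1 hM hA fun _ hc => barrier_le hL hc)

end

/-- The minimum over pasts splits in two: over the symbol y₁, that is, over preimages `w` of `x`,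
and over the rest of the past, which yields `fiberMin`. -/
theorem isCalibrated_iff {m₀ : ℕ} (hM : IsTransitive M m₀) (hA : Continuous A)
    {u : Shift M → ℝ} : IsCalibrated A u ↔ IsCalibratedFor (potential A) u := by
  constructor
  · rintro ⟨⟨hc, hsub⟩, hcal⟩
    refine ⟨hc, fun w => ?_, fun x => ?_⟩
    · obtain ⟨z, rfl, hz⟩ := exists_fiberMin_eq hM hA w
      have := hsub z
      rw [← shift_tau] at this
      unfold potential
      linarith
    · obtain ⟨z, rfl, hz⟩ := (hcal x).1
      refine ⟨tau z, rfl, ?_⟩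
      have := fiberMin_tau_le hA z
      unfold potential
      linarith
  · rintro ⟨hc, hle, hex⟩
    have hsub : ∀ z, u (proj z) ≤ u (tau z) + A z - minValue A := fun z => by
      have h1 := hle (tau z)
      have h2 := fiberMin_tau_le hA z
      rw [shift_tau] at h1
      unfold potential at h1
      linarith
    refine ⟨⟨hc, fun z => by linarith [hsub z]⟩, fun x => ⟨?_, ?_⟩⟩
    · obtain ⟨w, rfl, hw⟩ := hex x
      obtain ⟨z, rfl, hz⟩ := exists_fiberMin_eq hM hA w
      refine ⟨z, rfl, le_antisymm (hsub z) ?_⟩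
      unfold potential at hw
      linarith
    · rintro a ⟨z, rfl, rfl⟩
      exact hsub z

end HolonomicModel

/-! ### The representation theorem -/

theorem theorem3p6 {s : ℕ} (M : Matrix (Fin s) (Fin s) ℤ)
    (hM01 : ∀ i j, M i j = 0 ∨ M i j = 1) (hM : M.IsIrreducible)
    (lam : ℝ) (hlam0 : 0 < lam) (hlam1 : lam < 1)
    (A : HolonomicModel.NatExt M → ℝ) (hA : HolonomicModel.IsHolderObservable lam A)
    {r : ℕ} (C : Fin r → Set (HolonomicModel.Shift M))
    (hC : ∀ i, HolonomicModel.IsIrreducibleComponent lam A (C i))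
    (hdisj : Pairwise fun i j => Disjoint (C i) (C j))
    (hΩ : HolonomicModel.nonWandering lam A = ⋃ i, C i)
    (p : Fin r → HolonomicModel.Shift M) (hp : ∀ i, p i ∈ C i) :
    -- a calibrated sub-action is recovered from its values at the chosen points
    (∀ u, HolonomicModel.IsCalibrated A u →
      (fun i => u (p i)) ∈ HolonomicModel.constraintSet lam A p ∧
        HolonomicModel.IsMinFormula lam A p (fun i => u (p i)) u) ∧
    -- every element of the constraint set defines a calibrated sub-action with these values
    (∀ v ∈ HolonomicModel.constraintSet lam A p,
      ∃ u : HolonomicModel.Shift M → ℝ, HolonomicModel.IsMinFormula lam A p v u ∧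
        HolonomicModel.IsCalibrated A u ∧ ∀ i, u (p i) = v i) ∧
    -- hence evaluation at the chosen points is a bijection
    Set.BijOn (fun (u : HolonomicModel.Shift M → ℝ) (i : Fin r) => u (p i))
      {u | HolonomicModel.IsCalibrated A u} (HolonomicModel.constraintSet lam A p) ∧
    -- the elements generated by one component
    (∀ (i₀ : Fin r) (c : ℝ), ∃ v : Fin r → ℝ, v i₀ = c ∧
      (∀ i, (v i : EReal) = (v i₀ : EReal) + HolonomicModel.peierls lam A (p i₀) (p i)) ∧
      (∀ i₁, (∀ i, (v i : EReal) =
          (v i₁ : EReal) + HolonomicModel.peierls lam A (p i₁) (p i)) → i₁ = i₀) ∧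
      v ∈ HolonomicModel.constraintSet lam A p ∧
      ∃ u : HolonomicModel.Shift M → ℝ,
        (HolonomicModel.IsCalibrated A u ∧ ∀ i, u (p i) = v i) ∧
        (∀ w, HolonomicModel.IsCalibrated A w ∧ (∀ i, w (p i) = v i) → w = u) ∧
        HolonomicModel.IsMinFormula lam A p v u ∧
        ∀ x, (u x : EReal) = (v i₀ : EReal) + HolonomicModel.peierls lam A (p i₀) x) := by
  classical
  obtain ⟨m₀, hT⟩ := HolonomicModel.exists_isTransitive hM01 hM
  have hAc := hA.continuous hlam0 hlam1
  obtain ⟨K, ρ, hφ⟩ := HolonomicModel.exists_hasExpVariation_potential hlam0 hlam1 hT hA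
  obtain ⟨L, -, hL⟩ := hφ.exists_le_birkhoffSum hT
    (HolonomicModel.birkhoffSum_potential_nonneg_of_periodic hT hAc)
  set φ := HolonomicModel.potential A
  have hrec : ∀ x ∈ HolonomicModel.nonWandering lam A, HolonomicModel.IsRecurrent φ x :=
    fun x hx => HolonomicModel.isRecurrent_of_mem_nonWandering hlam0 hlam1 hAc hx
  have hfin : ∀ x ∈ HolonomicModel.nonWandering lam A, ∀ y,
      HolonomicModel.CostLE φ x y (HolonomicModel.barrier φ x y) := fun x hx y => by
    obtain ⟨c, hc⟩ := (hrec x hx).exists_costLE hφ hT y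
    exact HolonomicModel.costLE_barrier hc
  have hpei : ∀ x ∈ HolonomicModel.nonWandering lam A, ∀ y,
      HolonomicModel.peierls lam A x y = HolonomicModel.barrier φ x y := fun x hx y =>
    HolonomicModel.peierls_eq_barrier hlam0 hlam1 hT hAc hL (hfin x hx y)
  have htri : ∀ x ∈ HolonomicModel.nonWandering lam A, ∀ y ∈ HolonomicModel.nonWandering lam A,
      ∀ z, HolonomicModel.barrier φ x z ≤
        HolonomicModel.barrier φ x y + HolonomicModel.barrier φ y z := fun x hx y hy z =>
    HolonomicModel.barrier_le hL ((hfin x hx y).trans hφ (hfin y hy z))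
  have hself : ∀ x ∈ HolonomicModel.nonWandering lam A, HolonomicModel.barrier φ x x = 0 :=
    fun x hx => (hrec x hx).barrier_self hφ hL
  have hmem : ∀ i, ∀ x ∈ C i, x ∈ HolonomicModel.nonWandering lam A := fun i x hx => by
    rw [hΩ]
    exact mem_iUnion.2 ⟨i, hx⟩
  have hC' : ∀ i, ∀ x ∈ C i, ∀ y ∈ HolonomicModel.nonWandering lam A,
      (y ∈ C i ↔ HolonomicModel.barrier φ x y + HolonomicModel.barrier φ y x = 0) := by
    intro i x hx y hy
    obtain ⟨a, ha, hCa⟩ := hC i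
    have key : ∀ z ∈ HolonomicModel.nonWandering lam A,
        (z ∈ C i ↔ HolonomicModel.barrier φ a z + HolonomicModel.barrier φ z a = 0) := by
      intro z hz
      rw [hCa]
      change _ ∧ _ ∧ _ ↔ _
      rw [hpei a ha, hpei z hz]
      norm_cast
      exact ⟨fun h => h.2.2, fun h => ⟨ha, hz, h⟩⟩
    have hx' := hmem i x hx
    have h1 := (key x hx').1 hx
    rw [key y hy]
    -- Any point `x` of the class may replace its representative `a`: detours through the other
    -- point bound each loop cost from above, and loops have nonnegative cost.
    have t1 := htri a ha x hx' y
    have t2 := htri y hy x hx' a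
    have t3 := htri x hx' a ha y
    have t4 := htri y hy a ha x
    have t5 := htri a ha y hy a
    have t6 := htri x hx' y hy x
    rw [hself a ha] at t5
    rw [hself x hx'] at t6
    constructor <;> intro h <;> linarith
  have hpmem : ∀ i, p i ∈ HolonomicModel.nonWandering lam A := fun i => hmem i _ (hp i)
  have hbcal : ∀ i, HolonomicModel.IsCalibratedFor φ (HolonomicModel.barrier φ (p i)) := fun i =>
    HolonomicModel.isCalibratedFor_barrier hφ hL (hfin _ (hpmem i))
  have hcal : ∀ u, HolonomicModel.IsCalibrated A u ↔ HolonomicModel.IsCalibratedFor φ u :=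
    fun u => HolonomicModel.isCalibrated_iff hT hAc
  have hcon : ∀ v : Fin r → ℝ, v ∈ HolonomicModel.constraintSet lam A p ↔
      ∀ i j, v j - v i ≤ HolonomicModel.barrier φ (p i) (p j) := fun v =>
    forall_congr' fun i => forall_congr' fun j => by
      rw [hpei _ (hpmem i), EReal.coe_le_coe_iff]
  have hmin : ∀ v u, HolonomicModel.IsMinFormula lam A p v u ↔ ∀ x,
      (∃ i, v i + HolonomicModel.barrier φ (p i) x = u x) ∧
        ∀ i, u x ≤ v i + HolonomicModel.barrier φ (p i) x := fun v u =>
    forall_congr' fun x => by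
      simp only [IsLeast, mem_lowerBounds, mem_range, forall_exists_index,
        forall_apply_eq_imp_iff, hpei _ (hpmem _)]
      norm_cast
  have part1 : ∀ u, HolonomicModel.IsCalibrated A u →
      (fun i => u (p i)) ∈ HolonomicModel.constraintSet lam A p ∧
        HolonomicModel.IsMinFormula lam A p (fun i => u (p i)) u := by
    intro u hu
    rw [hcal] at hu
    have hle : ∀ x ∈ HolonomicModel.nonWandering lam A, ∀ y,
        u y - u x ≤ HolonomicModel.barrier φ x y := fun x hx y => hu.sub_le_of_costLE (hfin x hx y)
    rw [hcon, hmin]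
    refine ⟨fun i j => hle _ (hpmem i) _, fun x => ⟨?_, fun i => ?_⟩⟩
    · obtain ⟨q, hq, hqx⟩ := hu.exists_isNonWandering x
      have hq' := hq.mem_nonWandering hlam0 hlam1 hT hAc
      obtain ⟨i, hi⟩ := mem_iUnion.1 (hΩ ▸ hq')
      have h1 := (hC' i _ (hp i) q hq').1 hi
      have h2 := HolonomicModel.barrier_le hL hqx
      -- From u(x) ≥ u(q) + h(q, x), u(p_i) - u(q) ≤ h(q, p_i) = -h(p_i, q) and the triangle
      -- inequality, u(p_i) + h(p_i, x) ≤ u(x).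
      exact ⟨i, by linarith [htri _ (hpmem i) q hq' x, hle q hq' (p i), hle _ (hpmem i) x]⟩
    · linarith [hle _ (hpmem i) x]
  have huniq : ∀ u w, HolonomicModel.IsCalibrated A u → HolonomicModel.IsCalibrated A w →
      (∀ i, u (p i) = w (p i)) → u = w := by
    intro u w hu hw huw
    funext x
    have h1 := (part1 u hu).2 x
    have h2 := (part1 w hw).2 x
    simp only [huw] at h1
    exact EReal.coe_eq_coe_iff.1 (h1.unique h2)
  have part2 : ∀ v ∈ HolonomicModel.constraintSet lam A p,
      ∃ u : HolonomicModel.Shift M → ℝ, HolonomicModel.IsMinFormula lam A p v u ∧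
        HolonomicModel.IsCalibrated A u ∧ ∀ i, u (p i) = v i := by
    intro v hv
    rw [hcon] at hv
    -- The minimum needs a nonempty index set: a nonempty shift space contains a non-wandering
    -- point, hence there is a component.
    have hne : Nonempty (HolonomicModel.Shift M) → Nonempty (Fin r) := by
      rintro ⟨x⟩
      obtain ⟨q, hq⟩ := HolonomicModel.exists_isNonWandering hL
        (HolonomicModel.exists_birkhoffSum_potential_le hT hAc hφ.continuous x)
      obtain ⟨i, -⟩ := mem_iUnion.1 (hΩ ▸ hq.mem_nonWandering hlam0 hlam1 hT hAc)
      exact ⟨i⟩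
    rcases isEmpty_or_nonempty (HolonomicModel.Shift M) with hS | hS
    · refine ⟨fun _ => 0, isEmptyElim, (hcal _).2 ⟨continuous_const, isEmptyElim, isEmptyElim⟩,
        fun i => isEmptyElim (p i)⟩
    have hr : (Finset.univ : Finset (Fin r)).Nonempty := Finset.univ_nonempty_iff.2 (hne hS)
    refine ⟨fun x => Finset.univ.inf' hr fun i => v i + HolonomicModel.barrier φ (p i) x,
      (hmin _ _).2 fun x => ⟨?_, fun i => Finset.inf'_le _ (Finset.mem_univ i)⟩,
      (hcal _).2 (HolonomicModel.IsCalibratedFor.inf' hr fun i => (hbcal i).add_const (v i)),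
      fun j => le_antisymm ?_ ?_⟩
    · obtain ⟨i, -, hi⟩ := Finset.exists_mem_eq_inf' hr
        fun i => v i + HolonomicModel.barrier φ (p i) x
      exact ⟨i, hi.symm⟩
    · refine (Finset.inf'_le _ (Finset.mem_univ j)).trans_eq ?_
      rw [hself _ (hpmem j), add_zero]
    · exact Finset.le_inf' _ _ fun i _ => by linarith [hv i j]
  refine ⟨part1, part2, ⟨fun u hu => (part1 u hu).1, fun u hu w hw h => ?_, fun v hv => ?_⟩,
    fun i₀ c => ?_⟩
  · exact huniq u w hu hw (congrFun h)
  · obtain ⟨u, -, hu, huv⟩ := part2 v hv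
    exact ⟨u, hu, funext huv⟩
  · have hu : HolonomicModel.IsCalibrated A fun x => c + HolonomicModel.barrier φ (p i₀) x :=
      (hcal _).2 ((hbcal i₀).add_const c)
    have hvc : c + HolonomicModel.barrier φ (p i₀) (p i₀) = c := by
      rw [hself _ (hpmem i₀), add_zero]
    refine ⟨fun i => c + HolonomicModel.barrier φ (p i₀) (p i), hvc, fun i => ?_, fun i₁ h => ?_,
      (part1 _ hu).1, _, ⟨hu, fun _ => rfl⟩, fun w hw => huniq _ _ hw.1 hu hw.2, (part1 _ hu).2,
      fun x => ?_⟩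
    · beta_reduce
      rw [hpei _ (hpmem i₀), hvc]
      norm_cast
    · have h0 := h i₀
      beta_reduce at h0
      rw [hpei _ (hpmem i₁), hvc] at h0
      norm_cast at h0
      by_contra hne
      exact disjoint_left.1 (hdisj hne) (hp i₁)
        ((hC' i₀ _ (hp i₀) _ (hpmem i₁)).2 (by linarith))
    · beta_reduce
      rw [hpei _ (hpmem i₀), hvc]
      norm_cast
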